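/- A \emph{tournament} is a finite digraph obtained by choosing a direction for every edge of a complete graph; its \emph{order} is its number of vertices. A \emph{rooted tree} is a directed tree with a special vertex, the \emph{root}, such that there is a unique directed path from the root to any other vertex; a \emph{leaf} is a vertex of out-degree zero. For a positive integer $k$, a \emph{$k$-ary tree} is a rooted tree in which all non-leaf vertices have exactly $k$ children, except that possibly one non-leaf vertex has at most $k-1$ children. A $k$-ary spanning tree of a tournament $T$ is a subdigraph of $T$ that contains all vertices of $T$ and is a $k$-ary tree. Let $h(k)$ be the minimum integer $N$ such that every tournament of order at least $N$ contains a $k$-ary spanning tree (when such an $N$ exists). Theorem. $h(4)=10$; and $h(5)$ exists and satisfies $h(5)\ge 13$. That is: every tournament of order at least $10$ contains a $4$-ary spanning tree, and $10$ is the smallest integer with this property; and some integer $N$ has the property that every tournament of order at least $N$ contains a $5$-ary spanning tree, and every such $N$ is at least $13$. -/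

import Mathlib

namespace Digraph

variable {V : Type*}

/-- A tournament: an orientation of the complete graph on `V`, i.e. a loopless digraph in which
exactly one of the arcs `(x, y)`, `(y, x)` is present for any two distinct vertices `x`, `y`. -/
def IsTournament (T : Digraph V) : Prop :=
  (∀ x, ¬ T.Adj x x) ∧ ∀ x y, x ≠ y → Xor (T.Adj x y) (T.Adj y x)

/-- The number of out-neighbours (in a rooted tree: of children) of `v`. A vertex is a leaf
if this number is zero. -/
noncomputable def outDeg (R : Digraph V) (v : V) : ℕ :=
  {w | R.Adj v w}.ncard

/-- `p` is the list of vertices of a directed path in `R` from `x` to `y`. -/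
def IsDiPath (R : Digraph V) (x y : V) (p : List V) : Prop :=
  p.head? = some x ∧ p.getLast? = some y ∧ p.IsChain R.Adj ∧ p.Nodup

/-- A directed tree with vertex set `V`: a digraph without loops and without pairs of opposite
arcs whose underlying undirected graph is a tree. -/
def IsDirectedTree (R : Digraph V) : Prop :=
  (∀ x y, R.Adj x y → ¬ R.Adj y x) ∧ R.toSimpleGraphInclusive.IsTree

/-- A rooted tree with vertex set `V` and root `r`: a directed tree in which there is a unique
directed path from `r` to any other vertex. -/
def IsRootedTree (R : Digraph V) (r : V) : Prop :=
  R.IsDirectedTree ∧ ∀ v, v ≠ r → ∃! p : List V, R.IsDiPath r v p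

/-- A `k`-ary tree with vertex set `V`: a rooted tree in which all non-leaf vertices have exactly
`k` children, except possibly one non-leaf vertex, which has fewer than `k` children. -/
def IsKAryTree (R : Digraph V) (k : ℕ) : Prop :=
  (∃ r, R.IsRootedTree r) ∧
    (∀ v, R.outDeg v ≠ 0 → R.outDeg v = k ∨ R.outDeg v < k) ∧
    {v | R.outDeg v ≠ 0 ∧ R.outDeg v ≠ k}.Subsingleton

/-- `T` contains a `k`-ary spanning tree: a subdigraph on the whole vertex set that is a
`k`-ary tree. -/
def HasKArySpanningTree (T : Digraph V) (k : ℕ) : Prop :=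
  ∃ R : Digraph V, R ≤ T ∧ R.IsKAryTree k

end Digraph

/-- Every (finite) tournament of order at least `N` contains a `k`-ary spanning tree. -/
def EveryTournamentHasKArySpanningTree (k N : ℕ) : Prop :=
  ∀ (V : Type) [Fintype V], N ≤ Fintype.card V →
    ∀ T : Digraph V, T.IsTournament → T.HasKArySpanningTree k

/-- `hNum k` is the minimum integer `N` such that every tournament of order at least `N` contains a
`k`-ary spanning tree. (If there were no such `N`, this would be `0`; so a positive lower bound
on `hNum k` includes the existence of such an `N`.) -/
noncomputable def hNum (k : ℕ) : ℕ :=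
  sInf {N | EveryTournamentHasKArySpanningTree k N}

/-!
A `4`-ary tree of order `9` has only two inner vertices, so a tournament of order `9` in which any
two vertices have a common in-neighbour has no spanning `4`-ary tree; similarly for `5`-ary trees of
order `12` when any two vertices have two common in-neighbours. Such tournaments arise from the
Paley tournaments of orders `7` and `11` by repeating vertices.

Conversely, every `2 * k` vertices contain a vertex with `k` out-neighbours among them. Removing
these `k` out-neighbours and putting the star back into a spanning tree of the rest reduces the
claim for `k = 4` to the orders `10, …, 13`. Let `r` have maximum out-degree there. If `f` has large
out-degree and at most two common in-neighbours with `r`, then Hall's theorem turns `f`, `r` and a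
suitable third vertex into the inner vertices of a spanning tree. Otherwise, vertices with few
common in-neighbours with `r` have small out-degree, and the tournament has too few arcs, unless it
has order `13` and is regular. For `k = 5`, the stars are removed until a large transitive
subtournament absorbs the few remaining vertices.
-/

open Finset Digraph

namespace KAryTree

variable {V : Type*}

section Tournament

variable {T : Digraph V} (hT : T.IsTournament)

include hT

theorem adj_asymm {x y : V} (h : T.Adj x y) : ¬ T.Adj y x := by
  intro h'
  rcases eq_or_ne x y with rfl | hne
  · exact hT.1 x h
  · rcases hT.2 x y hne with h₁ | h₁
    · exact h₁.2 h'
    · exact h₁.2 h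

theorem adj_ne {x y : V} (h : T.Adj x y) : x ≠ y := by
  rintro rfl
  exact hT.1 x h

theorem adj_of_not_adj {x y : V} (hne : x ≠ y) (h : ¬ T.Adj x y) : T.Adj y x :=
  (hT.2 x y hne).elim (fun h₁ => absurd h₁.1 h) And.left

end Tournament

section OutTree

/-- `HasOutTree T S g`: the subtournament of `T` induced on `S` has a spanning out-tree (all arcs
directed away from the root) in which every vertex `v` has `g v` children. Out-trees are encoded as
the digraphs obtained from a single vertex by successively adding leaves, so that `g` vanishes
outside `S`. -/
inductive HasOutTree [DecidableEq V] (T : Digraph V) : Finset V → (V → ℕ) → Prop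
  | singleton (v : V) : HasOutTree T {v} 0
  | addLeaf {S : Finset V} {g : V → ℕ} {l c : V} (h : HasOutTree T S g) (hl : l ∈ S) (hc : c ∉ S)
      (hlc : T.Adj l c) : HasOutTree T (insert c S) (g + Pi.single l 1)

namespace HasOutTree

variable [DecidableEq V] {T : Digraph V} {S : Finset V} {g : V → ℕ}

theorem nonempty (h : HasOutTree T S g) : S.Nonempty := by
  cases h
  · exact singleton_nonempty _
  · exact insert_nonempty _ _

theorem apply_eq_zero (h : HasOutTree T S g) {v : V} (hv : v ∉ S) : g v = 0 := by
  induction h with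
  | singleton => rfl
  | addLeaf _ hl _ _ ih =>
    have hvl : v ≠ _ := fun e => hv (mem_insert_of_mem (e ▸ hl))
    simp [ih fun h => hv (mem_insert_of_mem h), hvl]

theorem sum_add_one (h : HasOutTree T S g) : ∑ v ∈ S, g v + 1 = #S := by
  induction h with
  | singleton v => simp
  | addLeaf h hl hc _ ih =>
    have hcl : _ ≠ _ := ne_of_mem_of_not_mem hl hc
    rw [card_insert_of_notMem hc, ← ih, sum_insert hc]
    simp [sum_add_distrib, h.apply_eq_zero hc, hl, hcl.symm]

theorem addChildren (h : HasOutTree T S g) {l : V} (hl : l ∈ S) {C : Finset V}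
    (hC : Disjoint C S) (hadj : ∀ c ∈ C, T.Adj l c) :
    HasOutTree T (S ∪ C) (g + Pi.single l #C) := by
  induction C using Finset.induction_on with
  | empty => simpa using h
  | insert c C hc ih =>
    obtain ⟨hcS, hC⟩ := disjoint_insert_left.1 hC
    have := (ih hC fun x hx => hadj x (mem_insert_of_mem hx)).addLeaf (mem_union_left C hl)
      (by simp [hcS, hc]) (hadj c (mem_insert_self c C))
    rwa [add_assoc, ← Pi.single_add, ← card_insert_of_notMem hc, ← union_insert] at this

theorem insert_of_adj (hT : T.IsTournament) (h : HasOutTree T S g) {q z : V} (hq : q ∉ S)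
    (hz : z ∈ S) (hqz : T.Adj q z) : HasOutTree T (insert q S) (g + Pi.single q 1) := by
  induction h generalizing z with
  | singleton v =>
    rw [mem_singleton] at hz hq
    subst hz
    simpa [pair_comm] using (singleton q).addLeaf (mem_singleton_self q)
      (by simpa using Ne.symm hq) hqz
  | @addLeaf S g l c h hl hc hlc ih =>
    obtain ⟨hqc, hqS⟩ : q ≠ c ∧ q ∉ S := by simpa using hq
    have hcq : c ∉ insert q S := by simp [hc, hqc.symm]
    rw [insert_comm]
    by_cases hex : ∃ y ∈ S, T.Adj q y
    · obtain ⟨y, hy, hqy⟩ := hex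
      rw [add_right_comm]
      exact (ih hqS hy hqy).addLeaf (mem_insert_of_mem hl) hcq hlc
    · -- now `q` dominates only the last leaf `c`, so it can subdivide the arc above `c`
      obtain rfl : z = c := (mem_insert.1 hz).resolve_right fun hz => hex ⟨z, hz, hqz⟩
      have hlq : T.Adj l q := adj_of_not_adj hT (ne_of_mem_of_not_mem hl hqS).symm
        fun hql => hex ⟨l, hl, hql⟩
      exact (h.addLeaf hl hqS hlq).addLeaf (mem_insert_self q S) hcq hqz

theorem of_sdiff_star (hT : T.IsTournament) {q z : V} {W : Finset V}
    (hWS : insert q W ⊆ S) (hW : ∀ w ∈ W, T.Adj q w) (hz : z ∈ S \ insert q W) (hqz : T.Adj q z)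
    (h : HasOutTree T (S \ insert q W) g) : HasOutTree T S (g + Pi.single q (#W + 1)) := by
  have hqW : q ∉ W := fun hq => hT.1 q (hW q hq)
  have hWT : Disjoint W (insert q (S \ insert q W)) :=
    disjoint_left.2 fun w hw => by simp [hw, ne_of_mem_of_not_mem hw hqW]
  have := (h.insert_of_adj hT (by simp) hz hqz).addChildren (mem_insert_self q _) hWT hW
  rwa [add_assoc, ← Pi.single_add, add_comm 1, insert_union, ← union_insert,
    sdiff_union_of_subset hWS] at this

theorem map {V' : Type*} [DecidableEq V'] {T' : Digraph V'} (f : V ↪ V')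
    (hf : ∀ x y, T.Adj x y → T'.Adj (f x) (f y)) (h : HasOutTree T S g) :
    HasOutTree T' (S.map f) (Function.extend f g 0) := by
  induction h with
  | singleton v =>
    have : Function.extend f (0 : V → ℕ) 0 = 0 := Function.extend_zero f
    rw [this, map_singleton]
    exact singleton _
  | @addLeaf S g l c _ hl hc hlc ih =>
    have hsingle : Function.extend f (Pi.single l 1 : V → ℕ) 0 = Pi.single (f l) 1 := by
      ext v
      by_cases hv : ∃ x, f x = v
      · obtain ⟨x, rfl⟩ := hv
        simp [f.injective.extend_apply, Pi.single_apply]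
      · rw [Function.extend_apply' _ _ _ hv, Pi.single_eq_of_ne]
        · rfl
        · rintro rfl
          exact hv ⟨l, rfl⟩
    have hadd := Function.extend_add f g (Pi.single l 1) (0 : V' → ℕ) 0
    rw [add_zero, hsingle] at hadd
    rw [hadd, map_insert]
    exact ih.addLeaf (mem_map_of_mem f hl) (by simpa using hc) (hf l c hlc)

end HasOutTree

end OutTree

section SpanningTree

/-- `R` is an out-tree with root `ρ` and vertex set `S`, all other vertices of `V` being isolated
in `R`. -/
structure IsOutTree (R : Digraph V) (ρ : V) (S : Finset V) : Prop where
  mem_of_adj : ∀ ⦃x y⦄, R.Adj x y → x ∈ S ∧ y ∈ S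
  asymm : ∀ x y, R.Adj x y → ¬ R.Adj y x
  parent_unique : ∀ ⦃x y z⦄, R.Adj x z → R.Adj y z → x = y
  not_adj_root : ∀ x, ¬ R.Adj x ρ
  exists_path : ∀ v ∈ S, ∃ p, R.IsDiPath ρ v p ∧ ∀ x ∈ p, x ∈ S

/-- The digraph `R` with the additional arc `(l, c)`. -/
def addArc (R : Digraph V) (l c : V) : Digraph V :=
  ⟨fun x y => R.Adj x y ∨ x = l ∧ y = c⟩

theorem isOutTree_bot (v : V) : IsOutTree (⊥ : Digraph V) v {v} where
  mem_of_adj _ _ h := h.elim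
  asymm _ _ h := h.elim
  parent_unique _ _ _ h := h.elim
  not_adj_root _ h := h.elim
  exists_path x hx := by
    obtain rfl := mem_singleton.1 hx
    exact ⟨[x], ⟨rfl, rfl, by simp, by simp⟩, by simp⟩

theorem isDiPath_append_singleton {R : Digraph V} {x y z : V} {p : List V}
    (h : R.IsDiPath x y p) (hyz : R.Adj y z) (hz : z ∉ p) : R.IsDiPath x z (p ++ [z]) := by
  obtain ⟨hhead, hlast, hchain, hnodup⟩ := h
  refine ⟨by simp [List.head?_append, hhead], by simp, ?_, ?_⟩
  · refine List.isChain_append.2 ⟨hchain, by simp, fun a ha b hb => ?_⟩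
    obtain rfl : y = a := Option.some_injective _ (hlast.symm.trans ha)
    obtain rfl : z = b := by simpa using hb
    exact hyz
  · simpa [List.nodup_append, hnodup] using fun a ha (e : a = z) => hz (e ▸ ha)

theorem IsOutTree.addArc [DecidableEq V] {R : Digraph V} {ρ l c : V} {S : Finset V}
    (h : IsOutTree R ρ S) (hl : l ∈ S) (hc : c ∉ S) :
    IsOutTree (addArc R l c) ρ (insert c S) where
  mem_of_adj := by
    rintro x y (hxy | ⟨rfl, rfl⟩)
    · exact ⟨mem_insert_of_mem (h.mem_of_adj hxy).1, mem_insert_of_mem (h.mem_of_adj hxy).2⟩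
    · exact ⟨mem_insert_of_mem hl, mem_insert_self _ _⟩
  asymm := by
    rintro x y (hxy | ⟨hxl, hyc⟩) (hyx | ⟨-, hxc⟩)
    · exact h.asymm x y hxy hyx
    · exact hc (hxc ▸ (h.mem_of_adj hxy).1)
    · exact hc (hyc ▸ (h.mem_of_adj hyx).1)
    · exact hc (hxc ▸ hxl ▸ hl)
  parent_unique := by
    rintro x y z (hxz | ⟨rfl, rfl⟩) (hyz | ⟨rfl, hz⟩)
    · exact h.parent_unique hxz hyz
    · exact absurd (h.mem_of_adj hxz).2 (hz ▸ hc)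
    · exact absurd (h.mem_of_adj hyz).2 hc
    · rfl
  not_adj_root := by
    rintro x (hx | ⟨rfl, rfl⟩)
    · exact h.not_adj_root x hx
    · obtain ⟨p, hp, hpS⟩ := h.exists_path x hl
      exact hc (hpS _ (List.mem_of_head? hp.1))
  exists_path v hv := by
    have lift : ∀ u ∈ S, ∃ p, (KAryTree.addArc R l c).IsDiPath ρ u p ∧ ∀ x ∈ p, x ∈ S := by
      intro u hu
      obtain ⟨p, ⟨hhead, hlast, hchain, hnodup⟩, hpS⟩ := h.exists_path u hu
      exact ⟨p, ⟨hhead, hlast, hchain.imp fun _ _ => Or.inl, hnodup⟩, hpS⟩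
    rcases mem_insert.1 hv with rfl | hv
    · obtain ⟨p, hp, hpS⟩ := lift l hl
      refine ⟨p ++ [v], isDiPath_append_singleton hp (Or.inr ⟨rfl, rfl⟩) fun hvp => hc (hpS v hvp),
        fun x hx => ?_⟩
      rcases List.mem_append.1 hx with hx | hx
      · exact mem_insert_of_mem (hpS x hx)
      · simp [List.mem_singleton.1 hx]
    · obtain ⟨p, hp, hpS⟩ := lift v hv
      exact ⟨p, hp, fun x hx => mem_insert_of_mem (hpS x hx)⟩

theorem outDeg_addArc [Finite V] [DecidableEq V] {R : Digraph V} {l c : V} (h : ¬ R.Adj l c) :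
    (addArc R l c).outDeg = R.outDeg + Pi.single l 1 := by
  ext v
  rw [Pi.add_apply]
  by_cases hv : v = l
  · subst hv
    have : {w | (addArc R v c).Adj v w} = insert c {w | R.Adj v w} := by
      ext w
      simp [addArc, or_comm]
    have hc : c ∉ {w | R.Adj v w} := h
    rw [Pi.single_eq_same, outDeg, this, Set.ncard_insert_of_notMem hc]
    rfl
  · simp [outDeg, addArc, hv]

theorem HasOutTree.exists_isOutTree [Finite V] [DecidableEq V] {T : Digraph V} {S : Finset V}
    {g : V → ℕ} (h : HasOutTree T S g) :
    ∃ R ≤ T, ∃ ρ, IsOutTree R ρ S ∧ R.outDeg = g := by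
  induction h with
  | singleton v => exact ⟨⊥, bot_le, v, isOutTree_bot v, by ext; simp [outDeg]⟩
  | @addLeaf S g l c _ hl hc hlc ih =>
    obtain ⟨R, hRT, ρ, hR, rfl⟩ := ih
    refine ⟨addArc R l c, ?_, ρ, hR.addArc hl hc,
      outDeg_addArc fun h => hc (hR.mem_of_adj h).2⟩
    rintro x y (hxy | ⟨rfl, rfl⟩)
    exacts [hRT hxy, hlc]

/-- Read backwards, a path is determined by its first vertex, as every vertex has at most one
parent and the root has none. -/
theorem reverse_path_unique {R : Digraph V} {ρ : V}
    (hunique : ∀ ⦃x y z⦄, R.Adj x z → R.Adj y z → x = y) (hρ : ∀ x, ¬ R.Adj x ρ) :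
    ∀ {p q : List V}, p.head? = q.head? → p.getLast? = some ρ → q.getLast? = some ρ →
      p.IsChain (flip R.Adj) → q.IsChain (flip R.Adj) → p = q
  | [], _, _, hp, _, _, _ | _ :: _, [], hp, _, _, _, _ => by simp at hp
  | [a], [b], h, _, _, _, _ => by simpa using h
  | [a], b :: b' :: q, h, hp, _, _, hqc => by
    obtain rfl : a = b := by simpa using h
    obtain rfl : a = ρ := by simpa using hp
    exact absurd (List.isChain_cons_cons.1 hqc).1 (hρ b')
  | a :: a' :: p, [b], h, _, hq, hpc, _ => by
    obtain rfl : a = b := by simpa using h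
    obtain rfl : a = ρ := by simpa using hq
    exact absurd (List.isChain_cons_cons.1 hpc).1 (hρ a')
  | a :: a' :: p, b :: b' :: q, h, hp, hq, hpc, hqc => by
    obtain rfl : a = b := by simpa using h
    obtain ⟨haa', hpc⟩ := List.isChain_cons_cons.1 hpc
    obtain ⟨hab', hqc⟩ := List.isChain_cons_cons.1 hqc
    obtain rfl : a' = b' := hunique haa' hab'
    rw [reverse_path_unique hunique hρ (p := a' :: p) (q := a' :: q) rfl
      (by simpa using hp) (by simpa using hq) hpc hqc]

theorem IsOutTree.path_unique {R : Digraph V} {ρ v : V} {S : Finset V} (h : IsOutTree R ρ S)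
    {p q : List V} (hp : R.IsDiPath ρ v p) (hq : R.IsDiPath ρ v q) : p = q := by
  obtain ⟨hp₁, hp₂, hp₃, -⟩ := hp
  obtain ⟨hq₁, hq₂, hq₃, -⟩ := hq
  refine List.reverse_injective (reverse_path_unique h.parent_unique h.not_adj_root ?_ ?_ ?_ ?_ ?_)
  · simp [hp₂, hq₂]
  · simp [hp₁]
  · simp [hq₁]
  · exact List.isChain_reverse.2 hp₃
  · exact List.isChain_reverse.2 hq₃

theorem toSimpleGraphInclusive_adj {R : Digraph V} (hR : ∀ x y, R.Adj x y → ¬ R.Adj y x) {x y : V} :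
    R.toSimpleGraphInclusive.Adj x y ↔ R.Adj x y ∨ R.Adj y x := by
  rw [toSimpleGraphInclusive, SimpleGraph.fromRel_adj, and_iff_right_iff_imp]
  rintro (h | h) rfl <;> exact hR _ _ h h

theorem card_edgeSet_eq_sum_outDeg [Fintype V] {R : Digraph V}
    (hR : ∀ x y, R.Adj x y → ¬ R.Adj y x) :
    Nat.card R.toSimpleGraphInclusive.edgeSet = ∑ v, R.outDeg v := by
  have hsum : ∑ v, R.outDeg v = Nat.card {e : V × V // R.Adj e.1 e.2} := by
    rw [Nat.card_congr (Equiv.subtypeProdEquivSigmaSubtype R.Adj), Nat.card_sigma]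
    rfl
  rw [hsum]
  symm
  refine Nat.card_eq_of_bijective (fun e => (⟨s(e.1.1, e.1.2),
    (toSimpleGraphInclusive_adj hR).2 (Or.inl e.2)⟩ : R.toSimpleGraphInclusive.edgeSet)) ⟨?_, ?_⟩
  · rintro ⟨⟨a, b⟩, hab⟩ ⟨⟨c, d⟩, hcd⟩ h
    rcases Sym2.eq_iff.1 (congrArg Subtype.val h) with ⟨rfl, rfl⟩ | ⟨rfl, rfl⟩
    · rfl
    · exact absurd hcd (hR _ _ hab)
  · rintro ⟨⟨x, y⟩, he⟩
    rcases (toSimpleGraphInclusive_adj hR).1 he with h | h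
    · exact ⟨⟨(x, y), h⟩, rfl⟩
    · exact ⟨⟨(y, x), h⟩, Subtype.ext Sym2.eq_swap⟩

theorem IsOutTree.reachable {R : Digraph V} {ρ : V} {S : Finset V} (h : IsOutTree R ρ S)
    {v : V} (hv : v ∈ S) : R.toSimpleGraphInclusive.Reachable ρ v := by
  obtain ⟨p, ⟨hhead, hlast, hchain, -⟩, -⟩ := h.exists_path v hv
  obtain ⟨q, rfl⟩ := List.head?_eq_some_iff.1 hhead
  rw [SimpleGraph.reachable_iff_reflTransGen]
  refine List.relationReflTransGen_of_exists_isChain_cons q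
    (hchain.imp fun _ _ hxy => (toSimpleGraphInclusive_adj h.asymm).2 (Or.inl hxy)) ?_
  rwa [List.getLast?_eq_some_getLast (List.cons_ne_nil _ _), Option.some_inj] at hlast

theorem IsOutTree.isRootedTree [Fintype V] {R : Digraph V} {ρ : V} (h : IsOutTree R ρ univ)
    (hsum : ∑ v, R.outDeg v + 1 = Fintype.card V) : R.IsRootedTree ρ := by
  refine ⟨⟨h.asymm, SimpleGraph.isTree_iff_connected_and_card.2 ⟨?_, ?_⟩⟩, fun v _ => ?_⟩
  · have : Nonempty V := ⟨ρ⟩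
    exact ⟨fun u v => (h.reachable (mem_univ u)).symm.trans (h.reachable (mem_univ v))⟩
  · rw [card_edgeSet_eq_sum_outDeg h.asymm, hsum, Nat.card_eq_fintype_card]
  · obtain ⟨p, hp, -⟩ := h.exists_path v (mem_univ v)
    exact ⟨p, hp, fun q hq => h.path_unique hq hp⟩

end SpanningTree

section Degrees

/-- `IsKAry k g`: the numbers of children `g v` are those allowed in a `k`-ary tree. -/
def IsKAry (k : ℕ) (g : V → ℕ) : Prop :=
  ∃ d, g d ≤ k ∧ ∀ v ≠ d, g v = 0 ∨ g v = k

/-- `IsFull k g`: every vertex is a leaf or has `k` children, so there is no exceptional vertex. -/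
def IsFull (k : ℕ) (g : V → ℕ) : Prop :=
  ∀ v, g v = 0 ∨ g v = k

variable [DecidableEq V] {k : ℕ} {g : V → ℕ} {q : V}

theorem IsFull.isKAry_add_single (hg : IsFull k g) (hq : g q = 0) {b : ℕ} (hb : b ≤ k) :
    IsKAry k (g + Pi.single q b) :=
  ⟨q, by simpa [hq] using hb, fun v hv => by simpa [hv] using hg v⟩

theorem IsFull.add_single (hg : IsFull k g) (hq : g q = 0) : IsFull k (g + Pi.single q k) := by
  intro v
  by_cases hv : v = q
  · simp [hv, hq]
  · simpa [hv] using hg v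

theorem IsKAry.add_single (hg : IsKAry k g) (hq : g q = 0) : IsKAry k (g + Pi.single q k) := by
  obtain ⟨d, hd, hg⟩ := hg
  refine ⟨d, ?_, fun v hv => ?_⟩
  · by_cases hdq : d = q
    · simp [hdq, hq]
    · simpa [hdq] using hd
  · by_cases hvq : v = q
    · simp [hvq, hq]
    · simpa [hvq] using hg v hv

/-- `T[S]` has a spanning `k`-ary tree. -/
def HasKTree (k : ℕ) (T : Digraph V) (S : Finset V) : Prop :=
  ∃ g, HasOutTree T S g ∧ IsKAry k g

theorem HasKTree.hasKArySpanningTree [Fintype V] {T : Digraph V} (h : HasKTree k T univ) :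
    T.HasKArySpanningTree k := by
  obtain ⟨g, hg, d, hd, hgd⟩ := h
  obtain ⟨R, hRT, ρ, hR, rfl⟩ := hg.exists_isOutTree
  have eq_d : ∀ v, R.outDeg v ≠ 0 ∧ R.outDeg v ≠ k → v = d := by
    intro v hv
    by_contra hvd
    exact (hgd v hvd).elim hv.1 hv.2
  refine ⟨R, hRT, ⟨ρ, hR.isRootedTree (by simpa using hg.sum_add_one)⟩, fun v _ => ?_,
    fun v hv w hw => (eq_d v hv).trans (eq_d w hw).symm⟩
  by_cases hvd : v = d
  · rw [hvd]
    exact hd.eq_or_lt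
  · have := hgd v hvd
    omega

theorem HasKTree.map {V' : Type*} [DecidableEq V'] {T : Digraph V} {T' : Digraph V'} {S : Finset V}
    (f : V ↪ V') (hf : ∀ x y, T.Adj x y → T'.Adj (f x) (f y)) (h : HasKTree k T S) :
    HasKTree k T' (S.map f) := by
  obtain ⟨g, hg, d, hd, hgd⟩ := h
  refine ⟨_, hg.map f hf, f d, by rwa [f.injective.extend_apply], fun v hv => ?_⟩
  by_cases hex : ∃ x, f x = v
  · obtain ⟨x, rfl⟩ := hex
    rw [f.injective.extend_apply]
    exact hgd x (by rintro rfl; exact hv rfl)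
  · exact Or.inl (Function.extend_apply' _ _ _ hex)

end Degrees

section LowerBound

variable {R T : Digraph V} {k : ℕ}

theorem exists_adj_of_isDiPath {x y : V} {p : List V} (h : R.IsDiPath x y p) (hne : x ≠ y) :
    (∃ u, R.Adj u y) ∧ ∃ w, R.Adj x w := by
  obtain ⟨hhead, hlast, hchain, -⟩ := h
  constructor
  · rcases List.eq_nil_or_concat' p with rfl | ⟨q, b, rfl⟩
    · simp at hhead
    rcases List.eq_nil_or_concat' q with rfl | ⟨q, a, rfl⟩
    · simp only [List.nil_append, List.head?_cons, List.getLast?_singleton] at hhead hlast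
      exact absurd (Option.some_injective _ (hhead.symm.trans hlast)) hne
    obtain rfl : b = y := by simpa using hlast
    exact ⟨a, (List.isChain_append.1 hchain).2.2 a (by simp) b (by simp)⟩
  · match p, hhead, hlast, hchain with
    | [a], hhead, hlast, _ =>
      exact absurd (Option.some_injective _ (hhead.symm.trans hlast)) hne
    | a :: b :: q, hhead, _, hchain =>
      obtain rfl : a = x := by simpa using hhead
      exact ⟨b, (List.isChain_cons_cons.1 hchain).1⟩

theorem exists_parent {r v : V} (hr : R.IsRootedTree r) (hv : v ≠ r) : ∃ u, R.Adj u v := by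
  obtain ⟨p, hp, -⟩ := hr.2 v hv
  exact (exists_adj_of_isDiPath hp hv.symm).1

theorem exists_adj_root [Nontrivial V] {r : V} (hr : R.IsRootedTree r) : ∃ w, R.Adj r w := by
  obtain ⟨v, hv⟩ := exists_ne r
  obtain ⟨p, hp, -⟩ := hr.2 v hv
  exact (exists_adj_of_isDiPath hp hv.symm).2

theorem sum_outDeg_add_one [Fintype V] (hR : R.IsDirectedTree) :
    ∑ v, R.outDeg v + 1 = Fintype.card V := by
  rw [← card_edgeSet_eq_sum_outDeg hR.1, (SimpleGraph.isTree_iff_connected_and_card.1 hR.2).2,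
    Nat.card_eq_fintype_card]

theorem isKAry_outDeg (hR : R.IsKAryTree k) : IsKAry k R.outDeg := by
  obtain ⟨⟨r, -⟩, hle, hsub⟩ := hR
  have le_k : ∀ v, R.outDeg v ≤ k := fun v => by
    have := hle v
    omega
  by_cases hex : ∃ d, R.outDeg d ≠ 0 ∧ R.outDeg d ≠ k
  · obtain ⟨d, hd⟩ := hex
    refine ⟨d, le_k d, fun v hv => ?_⟩
    by_contra! hv'
    exact hv (hsub hv' hd)
  · push Not at hex
    exact ⟨r, le_k r, fun v _ => or_iff_not_imp_left.2 (hex v)⟩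

theorem IsKAry.exists_card_eq [Fintype V] {g : V → ℕ} (hg : IsKAry k g) {m e : ℕ} (he : e < k)
    (hsum : ∑ v, g v = k * m + e) :
    ∃ (F : Finset V) (d : V), #F = m ∧ (∀ v ∉ F, v ≠ d → g v = 0) ∧ (d ∉ F → g d = e) := by
  classical
  obtain ⟨d, hd, hg⟩ := hg
  have hsum_erase : ∑ v ∈ univ.erase d, g v = k * #{v ∈ univ.erase d | g v = k} := by
    rw [← sum_filter_add_sum_filter_not _ (g · = k), sum_eq_zero (s := {v ∈ _ | g v ≠ k}),
      add_zero, sum_congr rfl fun v hv => (mem_filter.1 hv).2, sum_const, smul_eq_mul, mul_comm]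
    intro v hv
    have := hg v (by simpa using (mem_filter.1 hv).1)
    exact this.resolve_right (mem_filter.1 hv).2
  rw [← add_sum_erase _ _ (mem_univ d), hsum_erase] at hsum
  have hzero : ∀ v ∉ ({v ∈ univ.erase d | g v = k} : Finset V), v ≠ d → g v = 0 := by
    intro v hv hvd
    exact (hg v hvd).resolve_right fun h => hv (by simp [hvd, h])
  rcases hd.eq_or_lt with hd | hd
  · refine ⟨insert d {v ∈ univ.erase d | g v = k}, d, ?_, fun v hv hvd => ?_, by simp⟩
    · rw [card_insert_of_notMem (by simp)]
      have : k * (#{v ∈ univ.erase d | g v = k} + 1) = k * m + e := by rw [← hsum, hd]; ring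
      have := congrArg (· / k) this
      simpa [Nat.mul_add_div, Nat.zero_lt_of_lt he, Nat.div_eq_of_lt he] using this
    · exact hzero v (fun h => hv (mem_insert_of_mem h)) hvd
  · refine ⟨({v ∈ univ.erase d | g v = k} : Finset V), d, ?_, hzero, fun _ => ?_⟩
    · have := congrArg (· / k) hsum
      simpa [Nat.add_mul_div_left, Nat.mul_add_div, Nat.zero_lt_of_lt he, Nat.div_eq_of_lt he,
        Nat.div_eq_of_lt hd] using this
    · have := congrArg (· % k) hsum
      simpa [Nat.mod_eq_of_lt he, Nat.mod_eq_of_lt hd] using this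

theorem exists_internal_pair [Fintype V] (hR : R.IsKAryTree k) {e : ℕ} (he : e < k)
    (hV : Fintype.card V = 2 * k + 1 + e) :
    ∃ a b d, a ≠ b ∧ (d = a ∨ d = b ∨ {w | R.Adj d w}.ncard = e) ∧
      ∀ u v, R.Adj u v → u = a ∨ u = b ∨ u = d := by
  classical
  have hsum : ∑ v, R.outDeg v = k * 2 + e := by
    obtain ⟨r, hr⟩ := hR.1
    have := sum_outDeg_add_one hr.1
    omega
  obtain ⟨F, d, hF, hzero, hd⟩ := (isKAry_outDeg hR).exists_card_eq he hsum
  obtain ⟨a, b, hab, rfl⟩ := card_eq_two.1 hF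
  refine ⟨a, b, d, hab, ?_, fun u v huv => ?_⟩
  · by_contra! h
    exact h.2.2 (hd (by simp [h.1, h.2.1]))
  · by_contra! h
    have hv : v ∈ {w | R.Adj u w} := huv
    exact (Set.ncard_ne_zero_of_mem hv).elim (hzero u (by simp [h.1, h.2.1]) h.2.2)

theorem not_hasKArySpanningTree_of_common_inNeighbor [Fintype V] (hT : T.IsTournament) (hk : 0 < k)
    (hV : Fintype.card V = 2 * k + 1) (h : ∀ a b, ∃ y, T.Adj y a ∧ T.Adj y b) :
    ¬ T.HasKArySpanningTree k := by
  rintro ⟨R, hRT, hR⟩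
  obtain ⟨a, b, d, hab, hd, hinternal⟩ := exists_internal_pair hR (e := 0) hk hV
  obtain ⟨⟨r, hr⟩, -, -⟩ := hR
  have hd : d = a ∨ d = b ∨ ∀ w, ¬ R.Adj d w := by
    rwa [Set.ncard_eq_zero, Set.eq_empty_iff_forall_notMem] at hd
  have eq_or_eq : ∀ u v, R.Adj u v → u = a ∨ u = b := by
    intro u v huv
    rcases hinternal u v huv with h | h | rfl
    · exact Or.inl h
    · exact Or.inr h
    · exact or_assoc.2 hd |>.resolve_right fun h => h v huv
  have : Nontrivial V := ⟨a, b, hab⟩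
  obtain ⟨y, hya, hyb⟩ := h a b
  have hyr : y ≠ r := by
    rintro rfl
    obtain ⟨w, hw⟩ := exists_adj_root hr
    exact (eq_or_eq y w hw).elim (adj_ne hT hya) (adj_ne hT hyb)
  obtain ⟨u, hu⟩ := exists_parent hr hyr
  rcases eq_or_eq u y hu with rfl | rfl
  · exact adj_asymm hT hya (hRT hu)
  · exact adj_asymm hT hyb (hRT hu)

/-- If both arcs were present, then, as `y` is the only child of the root `d`, the parents of `a`
and `b` could only be each other. -/
theorem not_adj_and_adj_of_unique_child {a b d y : V} (hT : T.IsTournament) (hRT : R ≤ T)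
    (hr : R.IsRootedTree d) (hinternal : ∀ u v, R.Adj u v → u = a ∨ u = b ∨ u = d)
    (hchild : ∀ v, R.Adj d v → v = y) (hya : T.Adj y a) (hyb : T.Adj y b) :
    ¬ (T.Adj d a ∧ T.Adj d b) := by
  rintro ⟨hda, hdb⟩
  have parent : ∀ v, v ≠ d → v ≠ y → R.Adj a v ∨ R.Adj b v := by
    intro v hvd hvy
    obtain ⟨u, hu⟩ := exists_parent hr hvd
    rcases hinternal u v hu with rfl | rfl | rfl
    · exact Or.inl hu
    · exact Or.inr hu
    · exact absurd (hchild v hu) hvy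
  have hba : R.Adj b a := (parent a (adj_ne hT hda).symm (adj_ne hT hya).symm).resolve_left
    fun h => hT.1 a (hRT h)
  have hab : R.Adj a b := (parent b (adj_ne hT hdb).symm (adj_ne hT hyb).symm).resolve_right
    fun h => hT.1 b (hRT h)
  exact adj_asymm hT (hRT hab) (hRT hba)

theorem not_hasKArySpanningTree_of_two_common_inNeighbors [Fintype V] (hT : T.IsTournament)
    (hk : 2 ≤ k) (hV : Fintype.card V = 2 * k + 2)
    (h : ∀ a b, ∃ y z, y ≠ z ∧ (T.Adj y a ∧ T.Adj y b) ∧ T.Adj z a ∧ T.Adj z b) :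
    ¬ T.HasKArySpanningTree k := by
  rintro ⟨R, hRT, hR⟩
  obtain ⟨a, b, d, hab, hd, hinternal⟩ := exists_internal_pair hR (e := 1) hk hV
  obtain ⟨⟨r, hr⟩, -, -⟩ := hR
  have : Nontrivial V := ⟨a, b, hab⟩
  have adj_d : ∀ y, T.Adj y a ∧ T.Adj y b → y ≠ r → R.Adj d y := by
    intro y hy hyr
    obtain ⟨u, hu⟩ := exists_parent hr hyr
    rcases hinternal u y hu with rfl | rfl | rfl
    · exact absurd (hRT hu) (adj_asymm hT hy.1)
    · exact absurd (hRT hu) (adj_asymm hT hy.2)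
    · exact hu
  have main : ∀ y z, y ≠ z → T.Adj y a ∧ T.Adj y b → T.Adj z a ∧ T.Adj z b → y ≠ r → False := by
    intro y z hyz hy hz hyr
    have hdy := adj_d y hy hyr
    have hchild : ∀ v, R.Adj d v → v = y := by
      rcases hd with rfl | rfl | hd
      · exact absurd (hRT hdy) (adj_asymm hT hy.1)
      · exact absurd (hRT hdy) (adj_asymm hT hy.2)
      · obtain ⟨x, hx⟩ := Set.ncard_eq_one.1 hd
        have eq_x : ∀ v, R.Adj d v → v = x := fun v hv => hx.subset hv
        exact fun v hv => (eq_x v hv).trans (eq_x y hdy).symm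
    obtain rfl : z = r := by
      by_contra hzr
      exact hyz (hchild z (adj_d z hz hzr)).symm
    obtain ⟨w, hw⟩ := exists_adj_root hr
    obtain rfl : z = d := ((hinternal z w hw).resolve_left (adj_ne hT hz.1)).resolve_left
      (adj_ne hT hz.2)
    exact not_adj_and_adj_of_unique_child hT hRT hr hinternal hchild hy.1 hy.2 hz
  obtain ⟨y, z, hyz, hy, hz⟩ := h a b
  by_cases hyr : y = r
  · exact main z y hyz.symm hz hy (hyr ▸ hyz.symm)
  · exact main y z hyz hy hz hyr

/-- The tournament with vertices `0, …, n - 1` obtained from the circulant tournament modulo `p`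
with connection set `Q` by repeating the vertices `0, …, n - p - 1`. -/
def repeatedCirculant (p : ℕ) (Q : Finset ℕ) (n : ℕ) : Digraph (Fin n) :=
  ⟨fun i j => (j.val % p + p - i.val % p) % p ∈ Q ∨ (i.val % p = j.val % p ∧ i.val < j.val)⟩

instance (p : ℕ) (Q : Finset ℕ) (n : ℕ) : DecidableRel (repeatedCirculant p Q n).Adj :=
  fun i j => inferInstanceAs (Decidable
    ((j.val % p + p - i.val % p) % p ∈ Q ∨ (i.val % p = j.val % p ∧ i.val < j.val)))

-- The connection sets `{1, 2, 4}` and `{1, 3, 4, 5, 9}` below are the quadratic residues: in the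
-- Paley tournaments of orders `7` and `11` any two vertices have one, respectively two, common
-- in-neighbours.
theorem ten_le_of_everyTournamentHasKArySpanningTree {N : ℕ}
    (h : EveryTournamentHasKArySpanningTree 4 N) : 10 ≤ N := by
  by_contra! hN
  have hT : (repeatedCirculant 7 {1, 2, 4} 9).IsTournament := by
    unfold IsTournament Xor
    constructor <;> decide
  refine not_hasKArySpanningTree_of_common_inNeighbor hT four_pos (by simp) ?_
    (h (Fin 9) (by rw [Fintype.card_fin]; lia) _ hT)
  decide

theorem thirteen_le_of_everyTournamentHasKArySpanningTree {N : ℕ}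
    (h : EveryTournamentHasKArySpanningTree 5 N) : 13 ≤ N := by
  by_contra! hN
  have hT : (repeatedCirculant 11 {1, 3, 4, 5, 9} 12).IsTournament := by
    unfold IsTournament Xor
    constructor <;> decide
  refine not_hasKArySpanningTree_of_two_common_inNeighbors hT (by norm_num) (by simp) ?_
    (h (Fin 12) (by rw [Fintype.card_fin]; lia) _ hT)
  decide

end LowerBound

section OutNeighbors

/-- The set of out-neighbours of `v` in `S`. -/
noncomputable def outIn (T : Digraph V) (S : Finset V) (v : V) : Finset V :=
  open Classical in {w ∈ S | T.Adj v w}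

variable {T : Digraph V} {S : Finset V} {v w : V}

@[simp]
theorem mem_outIn : w ∈ outIn T S v ↔ w ∈ S ∧ T.Adj v w := by
  classical
  simp [outIn]

theorem outIn_subset : outIn T S v ⊆ S :=
  fun _ hw => (mem_outIn.1 hw).1

theorem outIn_subset_outIn {S' : Finset V} (hS : S ⊆ S') : outIn T S v ⊆ outIn T S' v :=
  fun _ hw => mem_outIn.2 ⟨hS (mem_outIn.1 hw).1, (mem_outIn.1 hw).2⟩

theorem sum_card_outIn (hT : T.IsTournament) (S : Finset V) :
    2 * ∑ v ∈ S, #(outIn T S v) = #S * (#S - 1) := by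
  classical
  have hin : ∑ v ∈ S, #(outIn T S v) = ∑ v ∈ S, #{w ∈ S | T.Adj w v} := by
    have := sum_card_bipartiteAbove_eq_sum_card_bipartiteBelow (s := S) (t := S) T.Adj
    convert this using 3
    · ext
      simp [bipartiteAbove]
    · simp [bipartiteBelow]
  have hdeg : ∀ v ∈ S, #(outIn T S v) + #{w ∈ S | T.Adj w v} = #S - 1 := by
    intro v hv
    rw [← card_erase_of_mem hv, ← card_union_of_disjoint]
    · congr 1
      ext w
      simp only [mem_union, mem_outIn, mem_filter, mem_erase]
      constructor
      · rintro (⟨hw, hvw⟩ | ⟨hw, hwv⟩)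
        · exact ⟨(adj_ne hT hvw).symm, hw⟩
        · exact ⟨adj_ne hT hwv, hw⟩
      · rintro ⟨hne, hw⟩
        exact (em (T.Adj v w)).imp (⟨hw, ·⟩) fun h => ⟨hw, adj_of_not_adj hT hne.symm h⟩
    · exact disjoint_left.2 fun w hw hw' =>
        adj_asymm hT (mem_outIn.1 hw).2 (mem_filter.1 hw').2
  rw [two_mul]
  nth_rewrite 2 [hin]
  rw [← sum_add_distrib, sum_congr rfl hdeg, sum_const, smul_eq_mul]

theorem exists_card_le_outIn (hT : T.IsTournament) (hS : S.Nonempty) :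
    ∃ v ∈ S, #S ≤ 2 * #(outIn T S v) + 1 := by
  by_contra! hlt
  have hsum : ∑ v ∈ S, 2 * #(outIn T S v) < ∑ v ∈ S, (#S - 1) :=
    sum_lt_sum_of_nonempty hS fun v hv => by
      have := hlt v hv
      omega
  rw [← mul_sum, sum_card_outIn hT, sum_const, smul_eq_mul] at hsum
  exact lt_irrefl _ hsum

theorem exists_addable_star [DecidableEq V] (hT : T.IsTournament) {U : Finset V} (hUS : U ⊆ S)
    {b : ℕ} (hb : 0 < b) (hU : 2 * b ≤ #U) :
    ∃ C ⊆ U, #C = b ∧ ∃ q ∈ C, ∀ g, HasOutTree T (S \ C) g →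
      HasOutTree T S (g + Pi.single q b) := by
  obtain ⟨q, hqU, hq⟩ := exists_card_le_outIn hT (card_pos.1 (by omega : 0 < #U))
  obtain ⟨W, hW, hWcard⟩ := exists_subset_card_eq (by omega : b - 1 ≤ #(outIn T U q))
  obtain ⟨z, hz, hzW⟩ := exists_mem_notMem_of_card_lt_card (by omega : #W < #(outIn T U q))
  have hqW : q ∉ W := fun h => hT.1 q (mem_outIn.1 (hW h)).2
  have hCU : insert q W ⊆ U := insert_subset hqU (hW.trans outIn_subset)
  rw [mem_outIn] at hz
  refine ⟨insert q W, hCU, by rw [card_insert_of_notMem hqW]; omega, q, mem_insert_self q W,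
    fun g hg => ?_⟩
  have := hg.of_sdiff_star hT (hCU.trans hUS) (fun w hw => (mem_outIn.1 (hW hw)).2)
    (by simp [hUS hz.1, hzW, (adj_ne hT hz.2).symm]) hz.2
  rwa [hWcard, Nat.sub_add_cancel hb] at this

theorem hasKTree_of_forall_sdiff [DecidableEq V] (hT : T.IsTournament) {k : ℕ} (hk : 0 < k)
    (hS : 2 * k ≤ #S) (h : ∀ C ⊆ S, #C = k → HasKTree k T (S \ C)) : HasKTree k T S := by
  obtain ⟨C, hCS, hC, q, hq, hstar⟩ := exists_addable_star hT Subset.rfl hk hS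
  obtain ⟨g, hg, hgk⟩ := h C hCS hC
  exact ⟨_, hstar g hg, hgk.add_single (hg.apply_eq_zero (by simp [hq]))⟩

end OutNeighbors

section Existence

variable {T : Digraph V} {k : ℕ}

/-- `Z` is transitive in `T`, expressed by saying that every nonempty subset of `Z` has a vertex
dominating the rest of that subset. -/
def IsTransitiveOn (T : Digraph V) (Z : Finset V) : Prop :=
  ∀ A ⊆ Z, A.Nonempty → ∃ a ∈ A, ∀ b ∈ A, b ≠ a → T.Adj a b

theorem IsTransitiveOn.mono {Z Z' : Finset V} (hZ : IsTransitiveOn T Z) (h : Z' ⊆ Z) :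
    IsTransitiveOn T Z' :=
  fun A hA => hZ A (hA.trans h)

variable [DecidableEq V]

theorem IsTransitiveOn.exists_initial {Z : Finset V} (hZ : IsTransitiveOn T Z) {j : ℕ}
    (hj : j ≤ #Z) : ∃ A ⊆ Z, #A = j ∧ ∀ a ∈ A, ∀ b ∈ Z \ A, T.Adj a b := by
  induction j with
  | zero => exact ⟨∅, by simp⟩
  | succ j ih =>
    obtain ⟨A, hAZ, rfl, hA⟩ := ih (by omega)
    obtain ⟨a, ha, hdom⟩ := hZ (Z \ A) sdiff_subset (by
      rw [← card_pos, card_sdiff_of_subset hAZ]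
      omega)
    rw [mem_sdiff] at ha
    refine ⟨insert a A, insert_subset ha.1 hAZ, card_insert_of_notMem ha.2, fun x hx b hb => ?_⟩
    simp only [mem_sdiff, mem_insert, not_or] at hb
    have hbA : b ∈ Z \ A := mem_sdiff.2 ⟨hb.1, hb.2.2⟩
    rcases mem_insert.1 hx with rfl | hx
    · exact hdom b hbA hb.2.1
    · exact hA x hx b hbA

omit [DecidableEq V] in
theorem exists_isTransitiveOn (hT : T.IsTournament) {m : ℕ} {S : Finset V} (hS : 2 ^ m ≤ #S) :
    ∃ Z ⊆ S, #Z = m ∧ IsTransitiveOn T Z := by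
  classical
  induction m generalizing S with
  | zero => exact ⟨∅, by simp, rfl, fun A hA hne => by simp [subset_empty.1 hA] at hne⟩
  | succ m ih =>
    have hpos : 0 < 2 ^ (m + 1) := by positivity
    obtain ⟨v, hv, hcard⟩ := exists_card_le_outIn hT (card_pos.1 (hpos.trans_le hS))
    obtain ⟨Z, hZ, rfl, hZtrans⟩ := ih (S := outIn T S v) (by
      rw [pow_succ] at hS
      omega)
    have hvZ : v ∉ Z := fun h => hT.1 v (mem_outIn.1 (hZ h)).2
    refine ⟨insert v Z, insert_subset hv (hZ.trans outIn_subset), card_insert_of_notMem hvZ,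
      fun A hA hne => ?_⟩
    by_cases hvA : v ∈ A
    · exact ⟨v, hvA, fun b hb hbv =>
        (mem_outIn.1 (hZ ((mem_insert.1 (hA hb)).resolve_left hbv))).2⟩
    · exact hZtrans A ((subset_insert_iff_of_notMem hvA).1 hA) hne

/-- `T[R]` has a spanning out-tree in which every vertex has `0` or `k` children and all vertices
of `L` are leaves. -/
def HasFullTree (k : ℕ) (T : Digraph V) (R L : Finset V) : Prop :=
  L ⊆ R ∧ ∃ g, HasOutTree T R g ∧ IsFull k g ∧ ∀ v ∈ L, g v = 0

variable {R L Z U : Finset V}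

theorem HasFullTree.hasKTree (h : HasFullTree k T R L) : HasKTree k T R := by
  obtain ⟨-, g, hg, hfull, -⟩ := h
  obtain ⟨r, -⟩ := hg.nonempty
  exact ⟨g, hg, r, (hfull r).elim (by omega) Eq.le, fun v _ => hfull v⟩

theorem HasFullTree.addChildren (h : HasFullTree k T R L) {l : V} (hl : l ∈ L) {C : Finset V}
    (hC : Disjoint C R) (hCcard : #C = k) (hadj : ∀ c ∈ C, T.Adj l c) :
    HasFullTree k T (R ∪ C) C := by
  obtain ⟨hLR, g, hg, hfull, hleaf⟩ := h
  refine ⟨subset_union_right, _, hg.addChildren (hLR hl) hC hadj,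
    hCcard ▸ hfull.add_single (hleaf l hl), fun v hv => ?_⟩
  have hvR : v ∉ R := disjoint_left.1 hC hv
  have hvl : v ≠ l := fun e => hvR (e ▸ hLR hl)
  simp [hg.apply_eq_zero hvR, hvl]

theorem HasFullTree.of_sdiff_star (hT : T.IsTournament) {S W : Finset V} {q z : V}
    (hWS : insert q W ⊆ S) (hWcard : #W + 1 = k) (hW : ∀ w ∈ W, T.Adj q w)
    (hz : z ∈ S \ insert q W) (hqz : T.Adj q z) (h : HasFullTree k T (S \ insert q W) ∅) :
    HasFullTree k T S ∅ := by
  obtain ⟨-, g, hg, hfull, -⟩ := h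
  exact ⟨empty_subset _, _, hg.of_sdiff_star hT hWS hW hz hqz,
    hWcard ▸ hfull.add_single (hg.apply_eq_zero (by simp)), by simp⟩

theorem HasFullTree.union_transitive (hk : 0 < k) {m : ℕ} (hZ : IsTransitiveOn T Z)
    (hZcard : #Z = k * m) (hRZ : Disjoint R Z) (h : HasFullTree k T R L) {z : V} (hz : z ∈ L)
    (hzZ : ∀ v ∈ Z, T.Adj z v) : HasFullTree k T (R ∪ Z) ∅ := by
  induction m generalizing R L Z z with
  | zero =>
    obtain ⟨-, g, hg, hfull, -⟩ := h
    rw [mul_zero, card_eq_zero] at hZcard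
    exact ⟨empty_subset _, g, by rwa [hZcard, union_empty], hfull, by simp⟩
  | succ m ih =>
    obtain ⟨A, hAZ, hA, hdom⟩ := hZ.exists_initial (j := k) (by rw [hZcard]; nlinarith)
    obtain ⟨a, ha⟩ := card_pos.1 (hA ▸ hk)
    have := ih (hZ.mono sdiff_subset) (by rw [card_sdiff_of_subset hAZ, hA, hZcard]; lia)
      (disjoint_union_left.2 ⟨hRZ.mono_right sdiff_subset, disjoint_sdiff⟩)
      (h.addChildren hz (hRZ.symm.mono_left hAZ) hA fun c hc => hzZ c (hAZ hc)) ha (hdom a ha)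
    rwa [union_assoc, union_sdiff_of_subset hAZ] at this

/-- A vertex `u` with few out-neighbours in the transitive set `Z` is dominated by one of the first
`k` vertices of `Z`, which can therefore take `u` as a child. -/
theorem HasFullTree.exists_absorb (hk : 2 ≤ k) (hT : T.IsTournament) (hZ : IsTransitiveOn T Z)
    (hZcard : 2 * k ≤ #Z) {u : V} (hu : u ∉ R ∪ Z) (hout : #(outIn T Z u) < k)
    (hRZ : Disjoint R Z) (h : HasFullTree k T R L) {z : V} (hz : z ∈ L)
    (hzZ : ∀ v ∈ Z, T.Adj z v) :
    ∃ B ⊆ Z, #B = 2 * k - 1 ∧ ∃ L', HasFullTree k T (insert u (R ∪ B)) L' ∧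
      ∃ z' ∈ L', ∀ v ∈ Z \ B, T.Adj z' v := by
  obtain ⟨A, hAZ, hA, hdomA⟩ := hZ.exists_initial (j := k) (by omega)
  obtain ⟨W, hWZ, hW, hdomW⟩ := (hZ.mono (sdiff_subset (t := A))).exists_initial (j := k - 1)
    (by rw [card_sdiff_of_subset hAZ]; omega)
  obtain ⟨y, hyA, hy⟩ := exists_mem_notMem_of_card_lt_card (hout.trans_eq hA.symm)
  have hyu : T.Adj y u := by
    refine adj_of_not_adj hT ?_ fun huy => hy (mem_outIn.2 ⟨hAZ hyA, huy⟩)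
    rintro rfl
    exact hu (mem_union_right R (hAZ hyA))
  have hAW : Disjoint A W := disjoint_of_subset_right hWZ disjoint_sdiff
  have hWZ' : W ⊆ Z := hWZ.trans sdiff_subset
  obtain ⟨z', hz'⟩ := card_pos.1 (by omega : 0 < #W)
  rw [mem_union, not_or] at hu
  have hRA := h.addChildren hz (hRZ.symm.mono_left hAZ) hA fun c hc => hzZ c (hAZ hc)
  refine ⟨A ∪ W, union_subset hAZ hWZ', by rw [card_union_of_disjoint hAW]; omega, insert u W, ?_,
    z', mem_insert_of_mem hz', fun v hv => hdomW z' hz' v (by grind)⟩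
  rw [← union_assoc, ← union_insert]
  refine hRA.addChildren hyA ?_ ?_ ?_
  · rw [disjoint_insert_left, disjoint_union_right, mem_union, not_or]
    exact ⟨⟨hu.1, fun h => hu.2 (hAZ h)⟩, hRZ.symm.mono_left hWZ', hAW.symm⟩
  · rw [card_insert_of_notMem fun h => hu.2 (hWZ' h)]
    omega
  · exact fun c hc => (mem_insert.1 hc).elim (· ▸ hyu) fun hc => hdomA y hyA c (hWZ hc)

theorem union_union_insert_sdiff_insert {u : V} {W : Finset V} (hWZ : W ⊆ Z)
    (hRZ : Disjoint R Z) (hU : Disjoint U (R ∪ Z)) (huRZ : u ∉ R ∪ Z) (hu : u ∉ U) :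
    (R ∪ Z ∪ insert u U) \ insert u W = R ∪ Z \ W ∪ U := by
  ext v
  have hvRZ : v ∈ R → v ∉ Z := fun h => Finset.disjoint_left.1 hRZ h
  have hvU : v ∈ U → v ∉ R ∪ Z := fun h => Finset.disjoint_left.1 hU h
  have hvWZ := @hWZ v
  grind

theorem HasFullTree.union_transitive_union (hk : 2 ≤ k) (hT : T.IsTournament)
    (hZ : IsTransitiveOn T Z) (hcard : 2 * k * #U ≤ #Z) (hdvd : k ∣ #Z + #U) (hRZ : Disjoint R Z)
    (hU : Disjoint U (R ∪ Z)) (h : HasFullTree k T R L) {z : V} (hz : z ∈ L)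
    (hzZ : ∀ v ∈ Z, T.Adj z v) : HasFullTree k T (R ∪ Z ∪ U) ∅ := by
  induction U using Finset.induction_on generalizing R L Z z with
  | empty =>
    obtain ⟨m, hm⟩ := hdvd
    rw [union_empty]
    exact h.union_transitive (by omega) hZ (by simpa using hm) hRZ hz hzZ
  | insert u U hu ih =>
    rw [card_insert_of_notMem hu] at hcard hdvd
    obtain ⟨huRZ, hU⟩ := disjoint_insert_left.1 hU
    have hZcard : 2 * k + 2 * k * #U ≤ #Z := by linarith
    by_cases hout : k ≤ #(outIn T Z u)
    · obtain ⟨W, hW, hWcard⟩ := exists_subset_card_eq (by omega : k - 1 ≤ #(outIn T Z u))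
      obtain ⟨x, hx, hxW⟩ := exists_mem_notMem_of_card_lt_card (by omega : #W < #(outIn T Z u))
      have hWZ := hW.trans outIn_subset
      have hsdiff := union_union_insert_sdiff_insert hWZ hRZ hU huRZ hu
      have hZW : #(Z \ W) + (k - 1) = #Z := by
        rw [← hWcard, card_sdiff_add_card_eq_card hWZ]
      rw [mem_outIn] at hx
      refine HasFullTree.of_sdiff_star hT (q := u) (W := W) (z := x) (by grind) (by omega)
        (fun w hw => (mem_outIn.1 (hW hw)).2) (by grind) hx.2 (hsdiff ▸ ?_)
      refine ih (hZ.mono sdiff_subset) (by omega) ?_ (hRZ.mono_right sdiff_subset)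
        (hU.mono_right (union_subset_union_right sdiff_subset)) h hz fun v hv =>
          hzZ v (sdiff_subset hv)
      rw [(by omega : #Z + (#U + 1) = #(Z \ W) + #U + k)] at hdvd
      exact (Nat.dvd_add_left dvd_rfl).1 hdvd
    · obtain ⟨B, hBZ, hB, L', hL', z', hz', hdom⟩ := h.exists_absorb hk hT hZ (by omega) huRZ
        (not_le.1 hout) hRZ hz hzZ
      have hZB : #(Z \ B) + (2 * k - 1) = #Z := by rw [← hB, card_sdiff_add_card_eq_card hBZ]
      have hunion : insert u (R ∪ B) ∪ Z \ B = insert u (R ∪ Z) := by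
        rw [insert_union, union_assoc, union_sdiff_of_subset hBZ]
      have := ih (hZ.mono sdiff_subset) (by omega) ?_ ?_ ?_ hL' hz' hdom
      · rwa [hunion, insert_union, ← union_insert] at this
      · rw [(by omega : #Z + (#U + 1) = #(Z \ B) + #U + k * 2)] at hdvd
        exact (Nat.dvd_add_left (dvd_mul_right k 2)).1 hdvd
      · rw [disjoint_insert_left, disjoint_union_left]
        exact ⟨fun hu => huRZ (mem_union_right R (sdiff_subset hu)),
          hRZ.mono_right sdiff_subset, disjoint_sdiff⟩
      · rw [hunion, disjoint_insert_right]
        exact ⟨hu, hU⟩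

theorem hasFullTree_of_isTransitiveOn (hk : 2 ≤ k) (hT : T.IsTournament)
    (hZ : IsTransitiveOn T Z) (hZcard : #Z = 1 + 4 * k ^ 2) {n : ℕ} (hU : Disjoint Z U)
    (hn : #U = n) (hmod : k ∣ #U + 4 * k ^ 2) : HasFullTree k T (Z ∪ U) ∅ := by
  induction n using Nat.strong_induction_on generalizing U with
  | _ n ih =>
    by_cases hsmall : 2 * k ≤ #U
    · obtain ⟨C, hCU, hC, q, hq, hstar⟩ :=
        exists_addable_star hT (subset_union_right (s₁ := Z)) (by omega : 0 < k) hsmall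
      have hUC : #(U \ C) + k = #U := by rw [← hC, card_sdiff_add_card_eq_card hCU]
      have hsdiff : (Z ∪ U) \ C = Z ∪ U \ C := by
        rw [union_sdiff_distrib, sdiff_eq_self_of_disjoint (hU.mono_right hCU)]
      obtain ⟨-, g, hg, hfull, -⟩ := ih #(U \ C) (by omega) (hU.mono_right sdiff_subset) rfl
        ((Nat.dvd_add_left (dvd_refl k)).1
          (by rwa [(by omega : #(U \ C) + 4 * k ^ 2 + k = #U + 4 * k ^ 2)]))
      rw [← hsdiff] at hg
      exact ⟨empty_subset _, _, hstar g hg,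
        hfull.add_single (hg.apply_eq_zero (by simp [hq])), by simp⟩
    · obtain ⟨A, hAZ, hA, hdom⟩ := hZ.exists_initial (j := 1) (by omega)
      obtain ⟨a, rfl⟩ := card_eq_one.1 hA
      have ha : HasFullTree k T {a} {a} :=
        ⟨Subset.rfl, 0, .singleton a, fun _ => Or.inl rfl, fun _ _ => rfl⟩
      have hZa : #(Z \ {a}) = 4 * k ^ 2 := by
        rw [card_sdiff_of_subset hAZ, hZcard, hA, Nat.add_sub_cancel_left]
      have := ha.union_transitive_union hk hT (hZ.mono sdiff_subset) (U := U)
        (by rw [hZa]; nlinarith) (by rwa [hZa, add_comm]) disjoint_sdiff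
        (by rw [union_sdiff_of_subset hAZ]; exact hU.symm) (mem_singleton_self a)
        (hdom a (mem_singleton_self a))
      rwa [union_sdiff_of_subset hAZ] at this

theorem exists_everyTournamentHasKArySpanningTree (hk : 2 ≤ k) :
    ∃ N, EveryTournamentHasKArySpanningTree k N := by
  classical
  have full : ∀ {V : Type} [DecidableEq V] {T : Digraph V} {S : Finset V}, T.IsTournament →
      2 ^ (1 + 4 * k ^ 2) ≤ #S → k ∣ #S - 1 → HasFullTree k T S ∅ := by
    intro V _ T S hT hS hdvd
    obtain ⟨Z, hZS, hZ, htrans⟩ := exists_isTransitiveOn hT hS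
    have hcard := card_sdiff_add_card_eq_card hZS
    have := hasFullTree_of_isTransitiveOn hk hT htrans hZ (disjoint_sdiff (t := S)) rfl
      (by rwa [(by omega : #(S \ Z) + 4 * k ^ 2 = #S - 1)])
    rwa [union_sdiff_of_subset hZS] at this
  refine ⟨2 ^ (1 + 4 * k ^ 2) + 2 * k, fun V _ hV T hT => HasKTree.hasKArySpanningTree ?_⟩
  rw [← card_univ] at hV
  have hmod := Nat.dvd_sub_mod (n := k) (#(univ : Finset V) - 1)
  have hlt : (#(univ : Finset V) - 1) % k < k := Nat.mod_lt _ (by omega)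
  obtain hb | hb := Nat.eq_zero_or_pos ((#(univ : Finset V) - 1) % k)
  · exact (full hT (by omega) (by rwa [hb] at hmod)).hasKTree
  · obtain ⟨C, -, hC, q, hq, hstar⟩ := exists_addable_star (S := univ) hT Subset.rfl hb
      (by have := Nat.one_le_two_pow (n := 1 + 4 * k ^ 2); omega)
    have hcard := card_sdiff_add_card_eq_card (subset_univ C)
    obtain ⟨-, g, hg, hfull, -⟩ := full (S := univ \ C) hT (by omega)
      (by rwa [(by omega : #(univ \ C) - 1 = #(univ : Finset V) - 1 - #C), hC])
    exact ⟨_, hstar g hg, hfull.isKAry_add_single (hg.apply_eq_zero (by simp [hq])) hlt.le⟩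

end Existence

section Hall

theorem exists_pairwise_disjoint_subset {ι α : Type*} [DecidableEq α] (D : ι → Finset α)
    (m : ι → ℕ) (hall : ∀ K : Finset ι, ∑ i ∈ K, m i ≤ #(K.biUnion D)) :
    ∃ C : ι → Finset α, (∀ i, C i ⊆ D i ∧ #(C i) = m i) ∧ ∀ i j, i ≠ j → Disjoint (C i) (C j) := by
  classical
  obtain ⟨f, hf, hfD⟩ := (all_card_le_biUnion_card_iff_exists_injective
    fun x : Σ i, Fin (m i) => D x.1).1 fun s => by
      have hs : s ⊆ (s.image Sigma.fst).sigma fun _ => univ := fun x hx =>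
        mem_sigma.2 ⟨mem_image_of_mem _ hx, mem_univ _⟩
      calc #s ≤ #((s.image Sigma.fst).sigma fun i => (univ : Finset (Fin (m i)))) :=
            card_le_card hs
        _ = ∑ i ∈ s.image Sigma.fst, m i := by simp
        _ ≤ #((s.image Sigma.fst).biUnion D) := hall _
        _ = #(s.biUnion fun x => D x.1) := by rw [image_biUnion]
  refine ⟨fun i => univ.image fun j => f ⟨i, j⟩, fun i => ⟨?_, ?_⟩, fun i j hij => ?_⟩
  · exact image_subset_iff.2 fun j _ => hfD ⟨i, j⟩
  · exact (card_image_of_injective univ (hf.comp sigma_mk_injective)).trans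
      (by rw [card_univ, Fintype.card_fin])
  · simp only [disjoint_left, mem_image, mem_univ, true_and]
    rintro _ ⟨x, rfl⟩ ⟨y, hy⟩
    exact hij (congrArg Sigma.fst (hf hy)).symm

theorem exists_three_disjoint_subsets {α : Type*} [DecidableEq α] {A B C : Finset α} {a b c : ℕ}
    (hA : a ≤ #A) (hB : b ≤ #B) (hC : c ≤ #C) (hAB : a + b ≤ #(A ∪ B)) (hAC : a + c ≤ #(A ∪ C))
    (hBC : b + c ≤ #(B ∪ C)) (hABC : a + b + c ≤ #(A ∪ B ∪ C)) :
    ∃ A' ⊆ A, ∃ B' ⊆ B, ∃ C' ⊆ C, (#A' = a ∧ #B' = b ∧ #C' = c) ∧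
      Disjoint A' B' ∧ Disjoint A' C' ∧ Disjoint B' C' := by
  obtain ⟨F, hF, hdisj⟩ := exists_pairwise_disjoint_subset ![A, B, C] ![a, b, c] fun K => by
    have hK : ∀ K : Finset (Fin 3), K = ∅ ∨ K = {0} ∨ K = {1} ∨ K = {2} ∨ K = {0, 1} ∨
        K = {0, 2} ∨ K = {1, 2} ∨ K = {0, 1, 2} := by decide
    rcases hK K with rfl | rfl | rfl | rfl | rfl | rfl | rfl | rfl <;>
      simp_all [← add_assoc, ← union_assoc]
  exact ⟨F 0, (hF 0).1, F 1, (hF 1).1, F 2, (hF 2).1, ⟨(hF 0).2, (hF 1).2, (hF 2).2⟩,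
    hdisj 0 1 (by decide), hdisj 0 2 (by decide), hdisj 1 2 (by decide)⟩

end Hall

section Criteria

/-- The set of out-neighbours of `v`. -/
noncomputable abbrev outs [Fintype V] (T : Digraph V) (v : V) : Finset V :=
  outIn T univ v

/-- The set of in-neighbours of `v`. -/
noncomputable def ins [Fintype V] (T : Digraph V) (v : V) : Finset V :=
  open Classical in {w | T.Adj w v}

/-- The set of common in-neighbours of `v` and `w`. -/
noncomputable def commonIn [Fintype V] (T : Digraph V) (v w : V) : Finset V :=
  open Classical in {x | T.Adj x v ∧ T.Adj x w}

variable [Fintype V] {T : Digraph V}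

theorem mem_outs {v w : V} : w ∈ outs T v ↔ T.Adj v w := by
  simp

@[simp]
theorem mem_ins {v w : V} : w ∈ ins T v ↔ T.Adj w v := by
  classical
  simp [ins]

@[simp]
theorem mem_commonIn {v w x : V} : x ∈ commonIn T v w ↔ T.Adj x v ∧ T.Adj x w := by
  classical
  simp [commonIn]

theorem commonIn_comm (v w : V) : commonIn T v w = commonIn T w v := by
  ext x
  simp [and_comm]

theorem adj_or_adj_of_notMem_commonIn (hT : T.IsTournament) {v w x : V} (hv : x ≠ v) (hw : x ≠ w)
    (hx : x ∉ commonIn T v w) : T.Adj v x ∨ T.Adj w x := by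
  by_contra! h
  exact hx (mem_commonIn.2 ⟨adj_of_not_adj hT hv.symm h.1, adj_of_not_adj hT hw.symm h.2⟩)

variable [DecidableEq V]

theorem card_outs_union_add_of_adj (hT : T.IsTournament) {a b : V} (hab : T.Adj a b) :
    #(outs T a ∪ outs T b) + #(commonIn T a b) + 1 = Fintype.card V := by
  have ha : a ∉ commonIn T a b := fun h => hT.1 a (mem_commonIn.1 h).1
  have hunion : outs T a ∪ outs T b ∪ insert a (commonIn T a b) = univ := by
    refine eq_univ_of_forall fun x => ?_
    by_cases hxa : x = a
    · simp [hxa]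
    by_cases hxb : x = b
    · simp [hxb, hab]
    have := adj_or_adj_of_notMem_commonIn hT hxa hxb
    grind [mem_outs]
  have hdisj : Disjoint (outs T a ∪ outs T b) (insert a (commonIn T a b)) := by
    rw [disjoint_left]
    have := adj_asymm hT hab
    have := @adj_asymm V T hT
    grind [mem_outs, mem_commonIn, hT.1]
  rw [← card_univ, ← hunion, card_union_of_disjoint hdisj, card_insert_of_notMem ha, add_assoc]

theorem card_outs_union_add (hT : T.IsTournament) {a b : V} (hab : a ≠ b) :
    #(outs T a ∪ outs T b) + #(commonIn T a b) + 1 = Fintype.card V := by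
  by_cases h : T.Adj a b
  · exact card_outs_union_add_of_adj hT h
  · rw [union_comm, commonIn_comm]
    exact card_outs_union_add_of_adj hT (adj_of_not_adj hT hab h)

theorem card_outs_add_card_le {v : V} {E X : Finset V} (hXE : X ⊆ E)
    (hX : ∀ x ∈ X, ¬ T.Adj v x) : #(outs T v) + #X ≤ #(outs T v ∪ E) := by
  rw [← card_union_of_disjoint (disjoint_right.2 fun x hx h => hX x hx (mem_outs.1 h))]
  exact card_le_card (union_subset_union_right hXE)

/-- No cycle can arise from assigning parents in this way, as it would have to consist of the arcs
`(x, y)` and `(y, x)`. -/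
theorem hasOutTree_of_partition (hT : T.IsTournament) {ρ x y : V} (hxρ : x ≠ ρ) (hyρ : y ≠ ρ)
    {P X Y : Finset V} (hP : P ⊆ outs T ρ) (hX : X ⊆ outs T x) (hY : Y ⊆ outs T y)
    (hPX : Disjoint P X) (hPY : Disjoint P Y) (hXY : Disjoint X Y)
    (hcover : P ∪ X ∪ Y = univ.erase ρ) :
    HasOutTree T univ (Pi.single ρ #P + Pi.single x #X + Pi.single y #Y) := by
  wlog hxP : x ∈ P generalizing x y X Y
  · rw [add_right_comm]
    refine this hyρ hxρ hY hX hPY hPX hXY.symm (by rw [union_right_comm, hcover]) ?_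
    have hx : x ∈ P ∪ X ∪ Y := by simp [hcover, hxρ]
    have hy : y ∈ P ∪ X ∪ Y := by simp [hcover, hyρ]
    have hxX : x ∉ X := fun h => hT.1 x (mem_outs.1 (hX h))
    have hyY : y ∉ Y := fun h => hT.1 y (mem_outs.1 (hY h))
    have hxy : ¬ (x ∈ Y ∧ y ∈ X) := fun h =>
      adj_asymm hT (mem_outs.1 (hY h.1)) (mem_outs.1 (hX h.2))
    grind
  have hρ : ρ ∉ P ∪ X ∪ Y := by simp [hcover]
  simp only [mem_union, not_or] at hρ
  have hy : y ∈ {ρ} ∪ P ∪ X := by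
    have hy : y ∈ P ∪ X ∪ Y := by simp [hcover, hyρ]
    have hyY : y ∉ Y := fun h => hT.1 y (mem_outs.1 (hY h))
    grind
  have htree := (((HasOutTree.singleton (T := T) ρ).addChildren (mem_singleton_self ρ) (C := P)
    (by simp [hρ.1.1]) fun c hc => mem_outs.1 (hP hc)).addChildren (mem_union_right _ hxP) (C := X)
    (by simp [hρ.1.2, hPX.symm]) fun c hc => mem_outs.1 (hX hc)).addChildren hy (C := Y)
    (by simp [hρ.2, hPY.symm, hXY.symm]) fun c hc => mem_outs.1 (hY hc)
  rwa [union_assoc, union_assoc, ← union_assoc P, hcover, ← insert_eq, insert_erase (mem_univ ρ),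
    zero_add] at htree

variable {k c : ℕ}

theorem hasKTree_of_hall (hT : T.IsTournament) (hc : c ≤ k) (hn : Fintype.card V = 2 * k + 1 + c)
    {a b q ρ : V} (hab : a ≠ b) (haq : a ≠ q) (hbq : b ≠ q) (hρ : ρ = a ∨ ρ = b ∨ ρ = q)
    {A B Q : Finset V} (hA : A ⊆ outs T a) (hB : B ⊆ outs T b) (hQ : Q ⊆ outs T q)
    (hcover : A ∪ B ∪ Q = univ.erase ρ) (hAk : k ≤ #A) (hBk : k ≤ #B) (hQc : c ≤ #Q)
    (hABk : 2 * k ≤ #(A ∪ B)) (hAQ : k + c ≤ #(A ∪ Q)) (hBQ : k + c ≤ #(B ∪ Q)) :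
    HasKTree k T univ := by
  have hcard : #(A ∪ B ∪ Q) = 2 * k + c := by
    rw [hcover, card_erase_of_mem (mem_univ ρ), card_univ]
    omega
  obtain ⟨A', hA', B', hB', Q', hQ', ⟨hA'k, hB'k, hQ'c⟩, hAB', hAQ', hBQ'⟩ :=
    exists_three_disjoint_subsets hAk hBk hQc (by omega) hAQ hBQ (by omega)
  have hcover' : A' ∪ B' ∪ Q' = univ.erase ρ := by
    rw [← hcover]
    refine eq_of_subset_of_card_le (by grind) ?_
    rw [card_union_of_disjoint (disjoint_union_left.2 ⟨hAQ', hBQ'⟩), card_union_of_disjoint hAB']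
    omega
  refine ⟨Pi.single a k + Pi.single b k + Pi.single q c, ?_, q, by simp [haq.symm, hbq.symm, hc],
    fun v hv => ?_⟩
  · have hA := hA'.trans hA
    have hB := hB'.trans hB
    have hQ := hQ'.trans hQ
    nth_rw 1 [← hA'k]
    nth_rw 1 [← hB'k]
    rw [← hQ'c]
    rcases hρ with rfl | rfl | rfl
    · exact hasOutTree_of_partition hT hab.symm haq.symm hA hB hQ hAB' hAQ' hBQ' hcover'
    · rw [add_comm (Pi.single a _)]
      exact hasOutTree_of_partition hT hab hbq.symm hB hA hQ hAB'.symm hBQ' hAQ'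
        (by rw [union_comm B', hcover'])
    · rw [add_comm, ← add_assoc]
      exact hasOutTree_of_partition hT haq hbq hQ hA hB hAQ'.symm hBQ'.symm hAB'
        (by rw [union_assoc, union_comm Q', hcover'])
  · by_cases hva : v = a
    · simp [hva, hab, haq]
    · by_cases hvb : v = b <;> simp [hva, hvb, hv, hab.symm, hbq]

/-- The inner vertices are `a`, `b`, `q`, with root `a`. -/
theorem hasKTree_of_root_left (hT : T.IsTournament) (hc : c ≤ k)
    (hn : Fintype.card V = 2 * k + 1 + c) {a b q : V} (hab : T.Adj a b) (hqa : q ≠ a) (hqb : q ≠ b)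
    (ha : k ≤ #(outs T a)) (hb : k ≤ #(outs T b)) {E : Finset V} (hE : E ⊆ outs T q) (haE : a ∉ E)
    (hcommon : commonIn T a b ⊆ E) (hcommonc : #(commonIn T a b) ≤ c) (hEc : c ≤ #E)
    (haE' : k + c ≤ #(outs T a ∪ E)) (hbE : k + c ≤ #(outs T b ∪ E)) : HasKTree k T univ := by
  have hcard := card_outs_union_add_of_adj hT hab
  refine hasKTree_of_hall hT hc hn (adj_ne hT hab) hqa.symm hqb.symm (Or.inl rfl) Subset.rfl
    Subset.rfl hE ?_ ha hb hEc (by omega) haE' hbE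
  have hba := adj_asymm hT hab
  ext x
  have := adj_or_adj_of_notMem_commonIn (x := x) hT (v := a) (w := b)
  have := hT.1 a
  grind [mem_outs]

/-- The inner vertices are `f`, `r`, `q`, with root `f` or `r`. -/
theorem hasKTree_of_root_left_or_right (hT : T.IsTournament) (hc : c ≤ k)
    (hn : Fintype.card V = 2 * k + 1 + c) {f r q : V} (hfr : f ≠ r) (hqf : q ≠ f) (hqr : q ≠ r)
    (hf : k ≤ #(outs T f)) (hr : k ≤ #(outs T r)) {E : Finset V} (hE : E ⊆ outs T q) (hfE : f ∉ E)
    (hrE : r ∉ E) (hcommon : commonIn T f r ⊆ E) (hcommonc : #(commonIn T f r) ≤ c) (hEc : c ≤ #E)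
    (hfE' : k + c ≤ #(outs T f ∪ E)) (hrE' : k + c ≤ #(outs T r ∪ E)) : HasKTree k T univ := by
  by_cases h : T.Adj f r
  · exact hasKTree_of_root_left hT hc hn h hqf hqr hf hr hE hfE hcommon hcommonc hEc hfE' hrE'
  · rw [commonIn_comm] at hcommon hcommonc
    exact hasKTree_of_root_left hT hc hn (adj_of_not_adj hT hfr h) hqr hqf hr hf hE hrE hcommon
      hcommonc hEc hrE' hfE'

/-- The inner vertices are `f`, `r`, `w`, with root `w`. -/
theorem hasKTree_of_root_above (hT : T.IsTournament) (hc : c ≤ k)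
    (hn : Fintype.card V = 2 * k + 1 + c) {f r w : V} (hfr : f ≠ r) (hwf : T.Adj w f)
    (hwr : T.Adj w r) (hf : k ≤ #(outs T f)) (hr : k ≤ #(outs T r))
    (hcommon : ∀ x ∈ commonIn T f r, x ≠ w → T.Adj w x) (hcommonc : #(commonIn T f r) ≤ c)
    (hw : c ≤ #(outs T w)) (hfw : k + c ≤ #(outs T f ∪ outs T w))
    (hrw : k + c ≤ #(outs T r ∪ outs T w)) : HasKTree k T univ := by
  have hcard := card_outs_union_add hT hfr
  refine hasKTree_of_hall hT hc hn hfr (adj_ne hT hwf).symm (adj_ne hT hwr).symm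
    (Or.inr (Or.inr rfl)) Subset.rfl Subset.rfl Subset.rfl ?_ hf hr hw (by omega) hfw hrw
  have hfw := adj_asymm hT hwf
  have hrw := adj_asymm hT hwr
  ext x
  have hx := adj_or_adj_of_notMem_commonIn (x := x) hT (v := f) (w := r)
  have hw := hT.1 w
  by_cases hxf : x = f
  · grind [mem_outs]
  · by_cases hxr : x = r <;> grind [mem_outs]

theorem card_outs_union_erase (hT : T.IsTournament) {f r q : V} (hfr : T.Adj f r)
    (hqf : T.Adj q f) (hrq : T.Adj r q) :
    #(outs T r ∪ (outs T q).erase f) = #((outs T r).erase q ∪ outs T q) := by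
  have hf : f ∉ outs T r ∪ (outs T q).erase f := by simpa using adj_asymm hT hfr
  have hq : q ∉ (outs T r).erase q ∪ outs T q := by simpa using hT.1 q
  rw [← Nat.add_right_cancel_iff (n := 1), ← card_insert_of_notMem hf, ← card_insert_of_notMem hq,
    ← union_insert, ← insert_union, insert_erase (mem_outs.2 hqf), insert_erase (mem_outs.2 hrq)]

/-- The inner vertices are `f`, `r`, `q`, with root `q` if `T.Adj f r` and root `r` otherwise. -/
theorem hasKTree_of_between (hT : T.IsTournament) (hc : c ≤ k)
    (hn : Fintype.card V = 2 * k + 1 + c) {f r q : V} (hfr : f ≠ r) (hqf : T.Adj q f)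
    (hrq : T.Adj r q) (hf : k ≤ #(outs T f)) (hr : k + 1 ≤ #(outs T r))
    (hcommon : commonIn T f r ⊆ outs T q) (hcommonc : #(commonIn T f r) + 1 ≤ c)
    (hq : c ≤ #(outs T q)) (hfq : k + c ≤ #(outs T f ∪ outs T q))
    (hrq' : k + c ≤ #(outs T r ∪ (outs T q).erase f)) : HasKTree k T univ := by
  have hqr := adj_asymm hT hrq
  by_cases h : T.Adj f r
  · have hcard := card_outs_union_add_of_adj hT h
    have hq_mem : q ∈ outs T r := mem_outs.2 hrq
    have hfq_not := adj_asymm hT hqf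
    refine hasKTree_of_hall hT hc hn hfr (adj_ne hT hqf).symm (adj_ne hT hrq)
      (Or.inr (Or.inr rfl)) Subset.rfl (B := (outs T r).erase q) (erase_subset _ _) Subset.rfl ?_ hf
      ?_ hq ?_ hfq (by rwa [← card_outs_union_erase hT h hqf hrq])
    · ext x
      have hx := adj_or_adj_of_notMem_commonIn (x := x) hT (v := f) (w := r)
      have hq := hT.1 q
      by_cases hxf : x = f
      · grind [mem_outs]
      · by_cases hxr : x = r <;> grind [mem_outs]
    · rw [card_erase_of_mem hq_mem]
      omega
    · have : #((outs T f ∪ outs T r).erase q) ≤ #(outs T f ∪ (outs T r).erase q) :=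
        card_le_card (by grind)
      rw [card_erase_of_mem (mem_union_right _ hq_mem)] at this
      omega
  · have hrf := adj_of_not_adj hT hfr h
    have hunion : outs T r ∪ (outs T q).erase f = outs T r ∪ outs T q := by
      ext x
      by_cases hx : x = f <;> simp [hx, hrf, hqf]
    rw [commonIn_comm] at hcommonc hcommon
    refine hasKTree_of_root_left hT hc hn hrf (adj_ne hT hrq).symm (adj_ne hT hqf) (by omega) hf
      Subset.rfl (by simpa using hqr) hcommon (by omega) hq (by rwa [← hunion]) hfq

end Criteria

section Neighborhoods

variable [Fintype V] {T : Digraph V} [DecidableEq V] {r s : V}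

omit [DecidableEq V] in
theorem disjoint_outs_ins (hT : T.IsTournament) (r : V) : Disjoint (outs T r) (ins T r) :=
  disjoint_left.2 fun _ hx hx' => adj_asymm hT (mem_outs.1 hx) (mem_ins.1 hx')

theorem insert_outs_union_ins (hT : T.IsTournament) (r : V) :
    insert r (outs T r ∪ ins T r) = univ := by
  refine eq_univ_of_forall fun x => ?_
  by_cases hx : x = r
  · simp [hx]
  by_cases h : T.Adj r x
  · simp [h]
  · simp [adj_of_not_adj hT (Ne.symm hx) h]

omit [DecidableEq V] in
theorem sum_eq_add_sum_outs_add_sum_ins {M : Type*} [AddCommMonoid M] (hT : T.IsTournament) (r : V)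
    (g : V → M) : ∑ v, g v = g r + (∑ v ∈ outs T r, g v + ∑ v ∈ ins T r, g v) := by
  classical
  rw [← insert_outs_union_ins hT r, sum_insert (by simp [hT.1 r]),
    sum_union (disjoint_outs_ins hT r)]

omit [DecidableEq V] in
theorem card_outs_add_card_ins (hT : T.IsTournament) (r : V) :
    #(outs T r) + #(ins T r) + 1 = Fintype.card V := by
  rw [← card_univ, card_eq_sum_ones univ, sum_eq_add_sum_outs_add_sum_ins hT r, ← card_eq_sum_ones,
    ← card_eq_sum_ones, add_comm 1]

omit [DecidableEq V] in
theorem card_outs_eq_of_adj (hT : T.IsTournament) (hsr : T.Adj s r) :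
    #(outs T s) = #(outIn T (outs T r) s) + #(outIn T (ins T r) s) + 1 := by
  classical
  have hcard (S : Finset V) : #(outIn T S s) = ∑ x ∈ S, if T.Adj s x then 1 else 0 := by
    rw [outIn, ← card_filter]
  simp only [hcard, sum_eq_add_sum_outs_add_sum_ins hT r, hsr, if_true, add_comm 1]

omit [DecidableEq V] in
theorem card_commonIn_add_card_outIn_ins (hT : T.IsTournament) (hsr : T.Adj s r) :
    #(commonIn T s r) + #(outIn T (ins T r) s) + 1 = #(ins T r) := by
  classical
  have hdisj : Disjoint (commonIn T s r) (outIn T (ins T r) s) := disjoint_left.2 fun x hx hx' =>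
    adj_asymm hT (mem_commonIn.1 hx).1 (mem_outIn.1 hx').2
  have hs : s ∉ commonIn T s r ∪ outIn T (ins T r) s := by simp [hT.1 s]
  have hins : insert s (commonIn T s r ∪ outIn T (ins T r) s) = ins T r := by
    ext x
    by_cases hxs : x = s
    · simp [hxs, hsr]
    have hor : T.Adj x s ∨ T.Adj s x := (em _).imp_right (adj_of_not_adj hT hxs)
    simp only [mem_insert, hxs, mem_union, mem_commonIn, mem_outIn, mem_ins]
    tauto
  rw [← card_union_of_disjoint hdisj, ← card_insert_of_notMem hs, hins]

end Neighborhoods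

section UniqueCommonInNeighbor

variable [Fintype V] {T : Digraph V} [DecidableEq V] {k c : ℕ} {f r w q : V}

theorem card_outs_add_card_outIn_commonIn_add_two_le (hT : T.IsTournament)
    (hwf : T.Adj w f) (hq : q ∈ commonIn T f w) :
    #(outs T f) + #(outIn T (commonIn T f w) q) + 2 ≤ #(outs T f ∪ outs T q) := by
  rw [mem_commonIn] at hq
  have hf : f ∉ insert w (outIn T (commonIn T f w) q) := by
    simp [(adj_ne hT hwf).symm, hT.1 f]
  have hw : w ∉ outIn T (commonIn T f w) q := by simp [hT.1 w]
  have hcard := card_outs_add_card_le (T := T) (v := f) (E := outs T q)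
    (X := insert f (insert w (outIn T (commonIn T f w) q)))
    (by grind [mem_outs, mem_outIn]) fun x hx => by
      rcases mem_insert.1 hx with rfl | hx
      · exact hT.1 x
      rcases mem_insert.1 hx with rfl | hx
      · exact adj_asymm hT hwf
      · exact adj_asymm hT (mem_commonIn.1 (mem_outIn.1 hx).1).1
  rwa [card_insert_of_notMem hf, card_insert_of_notMem hw] at hcard

theorem hasKTree_of_between_of_commonIn_eq_singleton (hT : T.IsTournament) (hc2 : 2 ≤ c)
    (hc : c ≤ k) (hn : Fintype.card V = 2 * k + 1 + c) (hfr : f ≠ r)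
    (hf : k ≤ #(outs T f)) (hr : k + c ≤ #(outs T r) + 1) (hw : commonIn T f r = {w})
    (hq : q ∈ commonIn T f w) (hqc : c ≤ #(outs T q)) (hfq : k + c ≤ #(outs T f ∪ outs T q)) :
    HasKTree k T univ := by
  obtain ⟨-, hwr⟩ : T.Adj w f ∧ T.Adj w r := mem_commonIn.1 (hw ▸ mem_singleton_self w)
  obtain ⟨hqf, hqw⟩ := mem_commonIn.1 hq
  have hrq : T.Adj r q := by
    refine adj_of_not_adj hT (fun h => adj_asymm hT hwr (h ▸ hqw)) fun h => adj_ne hT hqw ?_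
    exact mem_singleton.1 (hw ▸ mem_commonIn.2 ⟨hqf, h⟩)
  have hwf : w ≠ f := by
    rintro rfl
    exact hT.1 w (mem_commonIn.1 (hw ▸ mem_singleton_self w)).1
  have hrw : #(outs T r) + 1 ≤ #(outs T r ∪ (outs T q).erase f) :=
    card_outs_add_card_le (X := {w}) (by simp [hwf, hqw]) (by simpa using adj_asymm hT hwr)
  refine hasKTree_of_between hT hc hn hfr hqf hrq hf (by omega) ?_ ?_ hqc hfq (by omega)
  · simpa [hw] using hqw
  · rw [hw, card_singleton]
    omega

theorem hasKTree_of_not_adj_of_commonIn_eq_singleton (hT : T.IsTournament) (hc1 : 1 ≤ c)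
    (hc : c ≤ k) (hn : Fintype.card V = 2 * k + 1 + c) (hfr : f ≠ r) (hf : k ≤ #(outs T f))
    (hrk : k ≤ #(outs T r)) (hr : k + c ≤ #(outs T r) + 1) (hw : commonIn T f r = {w})
    (hqf : ¬ T.Adj q f) (hqw : T.Adj q w) (hq : c ≤ #(outIn T (ins T w) q) + 1) {X : Finset V}
    (hX : X ⊆ outIn T (ins T w) q) (hfX : ∀ x ∈ X, ¬ T.Adj f x)
    (hfXc : k + c ≤ #(outs T f) + #X + 1) : HasKTree k T univ := by
  obtain ⟨hwf, hwr⟩ : T.Adj w f ∧ T.Adj w r := mem_commonIn.1 (hw ▸ mem_singleton_self w)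
  have hwE : w ∉ outIn T (ins T w) q := by simp [hT.1 w]
  have hfE : #(outs T f) + #(insert w X) ≤ #(outs T f ∪ insert w (outIn T (ins T w) q)) :=
    card_outs_add_card_le (insert_subset_insert w hX)
      ((forall_mem_insert _ _ _).2 ⟨adj_asymm hT hwf, hfX⟩)
  have hrE : #(outs T r) + 1 ≤ #(outs T r ∪ insert w (outIn T (ins T w) q)) :=
    card_outs_add_card_le (X := {w}) (by simp) (by simpa using adj_asymm hT hwr)
  rw [card_insert_of_notMem fun h => hwE (hX h)] at hfE
  refine hasKTree_of_root_left_or_right hT hc hn hfr (fun h => adj_asymm hT hwf (h ▸ hqw))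
    (fun h => adj_asymm hT hwr (h ▸ hqw)) hf hrk (E := insert w (outIn T (ins T w) q)) ?_ ?_ ?_
    (by simp [hw]) (by simpa [hw]) (by rwa [card_insert_of_notMem hwE]) (by omega) (by omega)
  · exact insert_subset (mem_outs.2 hqw) fun x hx => mem_outs.2 (mem_outIn.1 hx).2
  · simp [hqf, (adj_ne hT hwf).symm]
  · simp [adj_asymm hT hwr, (adj_ne hT hwr).symm]

theorem hasKTree_of_four_le_card_commonIn (hT : T.IsTournament) (hc2 : 2 ≤ c) (hc : c ≤ 4)
    (hn : Fintype.card V = 9 + c) (hfr : f ≠ r) (hf : 4 ≤ #(outs T f)) (hr : 3 + c ≤ #(outs T r))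
    (hw : commonIn T f r = {w}) (hfw : 4 ≤ #(commonIn T f w)) : HasKTree 4 T univ := by
  have hwf : T.Adj w f := (mem_commonIn.1 (hw ▸ mem_singleton_self w)).1
  obtain ⟨q, hq, hqc⟩ := exists_card_le_outIn hT (card_pos.1 (by omega : 0 < #(commonIn T f w)))
  have hfq := card_outs_add_card_outIn_commonIn_add_two_le hT hwf hq
  have hq4 : #(insert f (insert w (outIn T (commonIn T f w) q))) ≤ #(outs T q) :=
    card_le_card (by grind [mem_outs, mem_outIn, mem_commonIn])
  rw [card_insert_of_notMem (by simp [(adj_ne hT hwf).symm, hT.1 f]),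
    card_insert_of_notMem (by simp [hT.1 w])] at hq4
  exact hasKTree_of_between_of_commonIn_eq_singleton hT hc2 hc hn hfr hf (by omega) hw hq
    (by omega)
    (by omega)

theorem hasKTree_of_forall_commonIn_not_adj (hT : T.IsTournament) (hc2 : 2 ≤ c) (hc : c ≤ 4)
    (hn : Fintype.card V = 9 + c) (hfr : f ≠ r) (hf : 5 ≤ #(outs T f)) (hr : 3 + c ≤ #(outs T r))
    (hw : commonIn T f r = {w}) (hqf : ¬ T.Adj q f) (hq : T.Adj q w)
    (hy : ∀ y ∈ commonIn T f w, ¬ T.Adj q y) (hfw : 2 ≤ #(commonIn T f w)) :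
    HasKTree 4 T univ := by
  have hwf : T.Adj w f := (mem_commonIn.1 (hw ▸ mem_singleton_self w)).1
  obtain ⟨y, hym, hyc⟩ := exists_card_le_outIn hT (card_pos.1 (by omega : 0 < #(commonIn T f w)))
  have hfy := card_outs_add_card_outIn_commonIn_add_two_le hT hwf hym
  obtain ⟨hyf, hyw⟩ := mem_commonIn.1 hym
  obtain ⟨x, hx⟩ := card_pos.1 (by omega : 0 < #(outIn T (commonIn T f w) y))
  obtain ⟨hxm, hyx⟩ := mem_outIn.1 hx
  obtain ⟨hxf, hxw⟩ := mem_commonIn.1 hxm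
  have hyq : T.Adj y q := adj_of_not_adj hT (by rintro rfl; exact hqf hyf) (hy y hym)
  have hy4 : #{f, w, q, x} ≤ #(outs T y) :=
    card_le_card (by simp [insert_subset_iff, hyf, hyw, hyq, hyx])
  have hqx : q ≠ x := by rintro rfl; exact hqf hxf
  have hqf' : f ≠ q := by rintro rfl; exact adj_asymm hT hwf hq
  rw [card_insert_of_notMem (by simp [(adj_ne hT hwf).symm, hqf', (adj_ne hT hxf).symm]),
    card_insert_of_notMem (by simp [(adj_ne hT hq).symm, (adj_ne hT hxw).symm]), card_pair hqx]
    at hy4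
  exact hasKTree_of_between_of_commonIn_eq_singleton hT (by omega) hc hn hfr (by omega) (by omega)
    hw hym (by omega) (by omega)

theorem hasKTree_of_card_outs_lt (hT : T.IsTournament) (hc : c ≤ 4)
    (hn : Fintype.card V = 9 + c) (hfr : f ≠ r) (hf : 6 ≤ #(outs T f)) (hr : 3 + c ≤ #(outs T r))
    (hw : commonIn T f r = {w}) (hwc : #(outs T w) < c)
    (hfw : 8 + c ≤ #(outs T f) + #(outs T w) + #(commonIn T f w)) : HasKTree 4 T univ := by
  obtain ⟨hwf, hwr⟩ : T.Adj w f ∧ T.Adj w r := mem_commonIn.1 (hw ▸ mem_singleton_self w)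
  have hw2 : #{f, r} ≤ #(outs T w) := card_le_card (by simp [insert_subset_iff, hwf, hwr])
  rw [card_pair hfr] at hw2
  have hins := card_outs_add_card_ins hT w
  obtain ⟨q, hq, hqc⟩ := exists_card_le_outIn hT (card_pos.1 (by omega : 0 < #(ins T w)))
  rw [mem_ins] at hq
  by_cases hqf : T.Adj q f
  · have hqins : #(outIn T (ins T w) q) ≤ #(outs T q) :=
      card_le_card fun x hx => mem_outs.2 (mem_outIn.1 hx).2
    have hqm := mem_commonIn.2 ⟨hqf, hq⟩
    have hfq := card_outs_add_card_outIn_commonIn_add_two_le hT hwf hqm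
    exact hasKTree_of_between_of_commonIn_eq_singleton hT (by omega) hc hn hfr (by omega)
      (by omega) hw hqm (by omega) (by omega)
  have htree {X : Finset V} (hX : X ⊆ outIn T (ins T w) q) (hfX : ∀ x ∈ X, ¬ T.Adj f x)
      (hfXc : 4 + c ≤ #(outs T f) + #X + 1) : HasKTree 4 T univ :=
    hasKTree_of_not_adj_of_commonIn_eq_singleton hT (by omega) hc hn hfr (by omega) (by omega)
      (by omega) hw hqf hq (by omega) hX hfX hfXc
  by_cases hf3 : 3 + c ≤ #(outs T f)
  · exact htree (empty_subset _) (by simp) (by rw [card_empty]; omega)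
  by_cases hy : ∃ y ∈ commonIn T f w, T.Adj q y
  · obtain ⟨y, hy, hqy⟩ := hy
    obtain ⟨hyf, hyw⟩ := mem_commonIn.1 hy
    exact htree (X := {y}) (by simp [hyw, hqy]) (by simpa using adj_asymm hT hyf)
      (by rw [card_singleton]; omega)
  · push Not at hy
    exact hasKTree_of_forall_commonIn_not_adj hT (by omega) hc hn hfr (by omega) hr hw hqf hq hy
      (by omega)

theorem hasKTree_of_commonIn_eq_singleton (hT : T.IsTournament) (hc1 : 1 ≤ c) (hc : c ≤ 4)
    (hn : Fintype.card V = 9 + c) (hfr : f ≠ r) (hf : 4 ≤ #(outs T f)) (hr4 : 4 ≤ #(outs T r))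
    (hr : 3 + c ≤ #(outs T r)) (hw : commonIn T f r = {w}) : HasKTree 4 T univ := by
  obtain ⟨hwf, hwr⟩ : T.Adj w f ∧ T.Adj w r := mem_commonIn.1 (hw ▸ mem_singleton_self w)
  have hfw := card_outs_union_add hT (adj_ne hT hwf).symm
  by_cases hw4 : c ≤ #(outs T w) ∧ 4 + c ≤ #(outs T f ∪ outs T w)
  · have hrw : #(outs T r) + 1 ≤ #(outs T r ∪ outs T w) :=
      card_outs_add_card_le (X := {r}) (by simpa using hwr) (by simpa using hT.1 r)
    exact hasKTree_of_root_above hT hc hn hfr hwf hwr hf hr4 (by simp [hw]) (by simpa [hw])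
      hw4.1 hw4.2 (by omega)
  have hf1 : #(outs T f) + 1 ≤ #(outs T f ∪ outs T w) :=
    card_outs_add_card_le (X := {f}) (by simpa using hwf) (by simpa using hT.1 f)
  have hle := card_union_le (outs T f) (outs T w)
  by_cases hm : 4 ≤ #(commonIn T f w)
  · exact hasKTree_of_four_le_card_commonIn hT (by omega) hc hn hfr hf hr hw hm
  · exact hasKTree_of_card_outs_lt hT hc hn hfr (by omega) hr hw (by omega) (by omega)

end UniqueCommonInNeighbor

section NoCommonInNeighbor

variable [Fintype V] {T : Digraph V} [DecidableEq V] {k c : ℕ} {f r q : V}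

omit [Fintype V] [DecidableEq V] in
theorem card_le_card_filter_lt_card_outIn_add (hT : T.IsTournament) (S : Finset V) (m : ℕ) :
    #S ≤ #{y ∈ S | m < #(outIn T S y)} + (2 * m + 1) := by
  rw [← card_filter_add_card_filter_not (s := S) fun y => m < #(outIn T S y)]
  gcongr
  set R : Finset V := {y ∈ S | ¬ m < #(outIn T S y)}
  rcases R.eq_empty_or_nonempty with h | h
  · simp [h]
  obtain ⟨v, hv, hvR⟩ := exists_card_le_outIn hT h
  have hRS : #(outIn T R v) ≤ #(outIn T S v) :=
    card_le_card (outIn_subset_outIn (filter_subset _ _))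
  have hvm : ¬ m < #(outIn T S v) := (mem_filter.1 hv).2
  omega

omit [DecidableEq V] in
theorem card_outIn_outs_add_card_outIn_add_one_le (hT : T.IsTournament) (hqf : T.Adj q f)
    {X : Finset V} (hX : X ⊆ ins T f) :
    #(outIn T (outs T f) q) + #(outIn T X q) + 1 ≤ #(outs T q) := by
  rw [card_outs_eq_of_adj hT hqf]
  gcongr
  exact outIn_subset_outIn hX

theorem card_outs_add_card_outIn_add_one_le (hT : T.IsTournament) (hqf : T.Adj q f) {X : Finset V}
    (hX : X ⊆ ins T f) : #(outs T f) + #(outIn T X q) + 1 ≤ #(outs T f ∪ outs T q) := by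
  have hf : f ∉ outIn T X q := fun h => hT.1 f (mem_ins.1 (hX (mem_outIn.1 h).1))
  rw [add_assoc, ← card_insert_of_notMem hf]
  refine card_outs_add_card_le
    (insert_subset (mem_outs.2 hqf) fun x hx => mem_outs.2 (mem_outIn.1 hx).2)
    ((forall_mem_insert _ _ _).2 ⟨hT.1 f, fun x hx => ?_⟩)
  exact adj_asymm hT (mem_ins.1 (hX (mem_outIn.1 hx).1))

theorem le_card_outs_add_card_ins_erase (hT : T.IsTournament) (f r : V) :
    Fintype.card V ≤ #(outs T f) + #((ins T f).erase r) + 2 := by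
  have hcard := card_outs_add_card_ins hT f
  have herase := pred_card_le_card_erase (s := ins T f) (a := r)
  omega

theorem hasKTree_of_between_of_commonIn_eq_empty (hT : T.IsTournament) (hc1 : 1 ≤ c) (hc : c ≤ k)
    (hn : Fintype.card V = 2 * k + 1 + c) (hfr : f ≠ r) (hf : k ≤ #(outs T f))
    (hr : k + 1 ≤ #(outs T r)) (hcommon : commonIn T f r = ∅) (hq : q ∈ (ins T f).erase r)
    (hqc : c ≤ #(outs T q)) (hfq : k + c ≤ #(outs T f ∪ outs T q))
    (hrq : k + c ≤ #(outs T r ∪ (outs T q).erase f)) : HasKTree k T univ := by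
  obtain ⟨hqr, hqf⟩ := mem_erase.1 hq
  rw [mem_ins] at hqf
  have hrq' : T.Adj r q := adj_of_not_adj hT hqr fun h =>
    notMem_empty q (hcommon ▸ mem_commonIn.2 ⟨hqf, h⟩)
  exact hasKTree_of_between hT hc hn hfr hqf hrq' hf hr (by simp [hcommon]) (by simpa [hcommon])
    hqc hfq hrq

theorem hasKTree_of_le_card_outs_of_commonIn_eq_empty (hT : T.IsTournament) (hk : 2 ≤ k)
    (hc1 : 1 ≤ c) (hc : c ≤ k) (hn : Fintype.card V = 2 * k + 1 + c) (hfr : f ≠ r)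
    (hf : k + c ≤ #(outs T f)) (hr : k + c ≤ #(outs T r)) (hcommon : commonIn T f r = ∅) :
    HasKTree k T univ := by
  set M : Finset V := univ \ {f, r}
  have hM : #M = 2 * k - 1 + c := by
    rw [card_sdiff_of_subset (subset_univ _), card_univ, card_pair hfr]
    omega
  obtain ⟨q, hqM, hq⟩ := exists_card_le_outIn hT (card_pos.1 (by omega : 0 < #M))
  obtain ⟨hqf', hqr⟩ : q ≠ f ∧ q ≠ r := by simpa [M] using hqM
  have hsub : outIn T M q ⊆ outs T q := fun x hx => mem_outs.2 (mem_outIn.1 hx).2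
  have hfE {E : Finset V} : k + c ≤ #(outs T f ∪ E) := hf.trans (card_le_card subset_union_left)
  have hrE {E : Finset V} : k + c ≤ #(outs T r ∪ E) := hr.trans (card_le_card subset_union_left)
  by_cases hqf : T.Adj q f
  · exact hasKTree_of_between_of_commonIn_eq_empty hT hc1 hc hn hfr (by omega) (by omega) hcommon
      (by simp [hqr, hqf] : q ∈ (ins T f).erase r) (by have := card_le_card hsub; omega) hfE hrE
  · exact hasKTree_of_root_left_or_right hT hc hn hfr hqf' hqr (by omega) (by omega) hsub
      (by simp [M]) (by simp [M]) (by simp [hcommon]) (by simp [hcommon]) (by omega) hfE hrE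

theorem hasKTree_of_card_outIn_outs_le (hT : T.IsTournament) (hc : c ≤ 4)
    (hn : Fintype.card V = 9 + c) (hfr : f ≠ r) (hf : 2 + c ≤ #(outs T f))
    (hr : 4 + c ≤ #(outs T r)) (hcommon : commonIn T f r = ∅) {H : Finset V}
    (hH : H ⊆ (ins T f).erase r) (hHcard : #H = 3)
    (hHf : ∀ y ∈ H, #(outIn T (outs T f) y) + 3 ≤ c) : HasKTree 4 T univ := by
  set G : Finset V := (outs T f).erase r \ H.biUnion (outIn T (outs T f))
  obtain ⟨y, hy⟩ := card_pos.1 (by omega : 0 < #H)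
  have hyc := hHf y hy
  have hU : #(H.biUnion (outIn T (outs T f))) ≤ 3 * (c - 3) :=
    hHcard ▸ card_biUnion_le_card_mul _ _ _ fun y hy => by have := hHf y hy; omega
  have hG : 2 ≤ #G := by
    have hdiff : _ ≤ #G := le_card_sdiff (H.biUnion (outIn T (outs T f))) ((outs T f).erase r)
    have herase := pred_card_le_card_erase (s := outs T f) (a := r)
    omega
  have hGf {x : V} (hx : x ∈ G) : x ≠ r ∧ T.Adj f x := by
    simpa using (mem_sdiff.1 hx).1
  have hGH {x y : V} (hx : x ∈ G) (hy : y ∈ H) : T.Adj x y := by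
    have hyf : T.Adj y f := mem_ins.1 (mem_of_mem_erase (hH hy))
    refine adj_of_not_adj hT ?_ fun h => (mem_sdiff.1 hx).2 ?_
    · rintro rfl
      exact adj_asymm hT hyf (hGf hx).2
    · exact mem_biUnion.2 ⟨y, hy, mem_outIn.2 ⟨mem_outs.2 (hGf hx).2, h⟩⟩
  obtain ⟨q, hqG, hq⟩ := exists_card_le_outIn hT (card_pos.1 (by omega : 0 < #G))
  obtain ⟨x, hx⟩ := card_pos.1 (by omega : 0 < #(outIn T G q))
  obtain ⟨hxG, hqx⟩ := mem_outIn.1 hx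
  obtain ⟨hqr, hfq⟩ := hGf hqG
  obtain ⟨hxr, hfx⟩ := hGf hxG
  have hHf' {y : V} (hy : y ∈ H) : ¬ T.Adj f y :=
    adj_asymm hT (mem_ins.1 (mem_of_mem_erase (hH hy)))
  have hfE := card_outs_add_card_le (T := T) (subset_insert x H) fun y hy => hHf' hy
  refine hasKTree_of_root_left_or_right hT hc hn hfr (adj_ne hT hfq).symm hqr (by omega) (by omega)
    (E := insert x H) ?_ ?_ ?_ (by simp [hcommon]) (by simp [hcommon]) ?_ (by omega)
    (hr.trans (card_le_card subset_union_left))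
  · exact insert_subset (mem_outs.2 hqx) fun y hy => mem_outs.2 (hGH hqG hy)
  · have hfH : f ∉ H := fun h => hT.1 f (mem_ins.1 (mem_of_mem_erase (hH h)))
    simp [adj_ne hT hfx, hfH]
  · have hrH : r ∉ H := fun h => ne_of_mem_erase (hH h) rfl
    simp [hxr.symm, hrH]
  · rw [card_insert_of_notMem fun h => hHf' h hfx]
    omega

theorem hasKTree_of_commonIn_eq_empty_of_four_add_le (hT : T.IsTournament) (hc1 : 1 ≤ c)
    (hc : c ≤ 4) (hn : Fintype.card V = 9 + c) (hfr : f ≠ r) (hf : 4 ≤ #(outs T f))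
    (hr : 4 + c ≤ #(outs T r)) (hcommon : commonIn T f r = ∅) : HasKTree 4 T univ := by
  have hY := le_card_outs_add_card_ins_erase hT f r
  have hYf := erase_subset r (ins T f)
  set Y := (ins T f).erase r
  have hbetween {y : V} (hy : y ∈ Y) (hyc : c ≤ #(outs T y))
      (hfy : 3 + c ≤ #(outs T f) + #(outIn T Y y)) : HasKTree 4 T univ := by
    have := card_outs_add_card_outIn_add_one_le hT (mem_ins.1 (hYf hy)) hYf
    exact hasKTree_of_between_of_commonIn_eq_empty hT hc1 hc hn hfr hf (by omega) hcommon hy hyc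
      (by omega) (hr.trans (card_le_card subset_union_left))
  by_cases hY3 : ∃ y ∈ Y, 3 ≤ #(outIn T Y y)
  · obtain ⟨y, hy, hy3⟩ := hY3
    have := card_outIn_outs_add_card_outIn_add_one_le hT (mem_ins.1 (hYf hy)) hYf
    exact hbetween hy (by omega) (by omega)
  push Not at hY3
  have hY5 : #Y ≤ 5 := by
    rcases Y.eq_empty_or_nonempty with h | h
    · simp [h]
    · obtain ⟨y, hy, hyY⟩ := exists_card_le_outIn hT h
      have := hY3 y hy
      omega
  by_cases hf4 : 4 + c ≤ #(outs T f)
  · exact hasKTree_of_le_card_outs_of_commonIn_eq_empty hT (by norm_num) hc1 hc hn hfr hf4 hr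
      hcommon
  by_cases hY1 : ∃ y ∈ Y, c ≤ #(outs T y) ∧ 0 < #(outIn T Y y)
  · obtain ⟨y, hy, hyc, hy1⟩ := hY1
    exact hbetween hy hyc (by omega)
  push Not at hY1
  obtain ⟨H, hH, hHcard⟩ := exists_subset_card_eq
    (by have := card_le_card_filter_lt_card_outIn_add hT Y 0; omega :
      3 ≤ #{y ∈ Y | 0 < #(outIn T Y y)})
  refine hasKTree_of_card_outIn_outs_le hT hc hn hfr (by omega) hr hcommon
    (hH.trans (filter_subset _ _)) hHcard fun y hy => ?_
  obtain ⟨hyY, hy1⟩ := mem_filter.1 (hH hy)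
  have hcard := card_outIn_outs_add_card_outIn_add_one_le hT (mem_ins.1 (hYf hyY)) hYf
  have hyc : ¬ c ≤ #(outs T y) := fun h => by have := hY1 y hyY h; omega
  omega

theorem hasKTree_of_commonIn_eq_empty_of_adj (hT : T.IsTournament) (hc1 : 1 ≤ c) (hc : c ≤ 4)
    (hn : Fintype.card V = 9 + c) (hfr : f ≠ r) (hf : 5 ≤ #(outs T f)) (hr5 : 5 ≤ #(outs T r))
    (hr : 3 + c ≤ #(outs T r)) (hcommon : commonIn T f r = ∅) {y z : V}
    (hy : y ∈ (ins T f).erase r) (hyc : c ≤ #(outIn T ((ins T f).erase r) y) + 2)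
    (hz : z ∈ (ins T r).erase f) (hyz : T.Adj y z) : HasKTree 4 T univ := by
  have hYf := erase_subset r (ins T f)
  have hyf := mem_ins.1 (hYf hy)
  obtain ⟨hzf, hzr⟩ := mem_erase.1 hz
  rw [mem_ins] at hzr
  have hfz : T.Adj f z := adj_of_not_adj hT hzf fun h =>
    notMem_empty z (hcommon ▸ mem_commonIn.2 ⟨h, hzr⟩)
  have hy1 : 0 < #(outIn T (outs T f) y) := card_pos.2 ⟨z, by simp [hfz, hyz]⟩
  have hyout := card_outIn_outs_add_card_outIn_add_one_le hT hyf hYf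
  have hfy := card_outs_add_card_outIn_add_one_le hT hyf hYf
  have hry : #(outs T r) + 1 ≤ #(outs T r ∪ (outs T y).erase f) :=
    card_outs_add_card_le (X := {z}) (by simp [hzf, hyz]) (by simpa using adj_asymm hT hzr)
  exact hasKTree_of_between_of_commonIn_eq_empty hT hc1 hc hn hfr (by omega) hr5 hcommon hy
    (by omega) (by omega) (by omega)

theorem hasKTree_of_commonIn_eq_empty_of_eq_three_add (hT : T.IsTournament) (hc2 : 2 ≤ c)
    (hc : c ≤ 4) (hn : Fintype.card V = 9 + c) (hfr : f ≠ r) (hf : 5 ≤ #(outs T f))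
    (hfr' : #(outs T f) ≤ #(outs T r)) (hr : #(outs T r) = 3 + c) (hcommon : commonIn T f r = ∅) :
    HasKTree 4 T univ := by
  have hY := le_card_outs_add_card_ins_erase hT f r
  have hZ := le_card_outs_add_card_ins_erase hT r f
  have hYf := erase_subset r (ins T f)
  have hZr := erase_subset f (ins T r)
  by_cases hadj : ∃ y ∈ (ins T f).erase r, c ≤ #(outIn T ((ins T f).erase r) y) + 2 ∧
      ∃ z ∈ (ins T r).erase f, T.Adj y z
  · obtain ⟨y, hy, hyc, z, hz, hyz⟩ := hadj
    exact hasKTree_of_commonIn_eq_empty_of_adj hT (by omega) hc hn hfr hf (by omega) hr.ge hcommon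
      hy hyc hz hyz
  push Not at hadj
  set Y := (ins T f).erase r
  set Z := (ins T r).erase f
  have hlow := card_le_card_filter_lt_card_outIn_add hT Y (c - 3)
  set Y' : Finset V := {y ∈ Y | c - 3 < #(outIn T Y y)}
  have hY'f {y : V} (hy : y ∈ Y') : T.Adj y f := mem_ins.1 (hYf (mem_filter.1 hy).1)
  have hZY' {y z : V} (hz : z ∈ Z) (hy : y ∈ Y') : T.Adj z y := by
    obtain ⟨hyY, hyc⟩ := mem_filter.1 hy
    refine adj_of_not_adj hT ?_ (hadj y hyY (by omega) z hz)
    rintro rfl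
    exact notMem_empty y (hcommon ▸ mem_commonIn.2 ⟨hY'f hy, mem_ins.1 (hZr hz)⟩)
  obtain ⟨z, hz, hzZ⟩ := exists_card_le_outIn hT (card_pos.1 (by omega : 0 < #Z))
  have hzr := mem_ins.1 (hZr hz)
  have hrz := card_outs_add_card_outIn_add_one_le hT hzr hZr
  have hfz : #(outs T f) + #Y' ≤ #(outs T f ∪ (outs T z).erase r) :=
    card_outs_add_card_le
      (fun y hy => mem_erase.2 ⟨ne_of_mem_erase (mem_filter.1 hy).1, mem_outs.2 (hZY' hz hy)⟩)
      fun y hy => adj_asymm hT (hY'f hy)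
  have hzY : #Y' ≤ #(outIn T (outs T r) z) := card_le_card fun y hy => by
    have hyr : y ≠ r := ne_of_mem_erase (mem_filter.1 hy).1
    refine mem_outIn.2 ⟨mem_outs.2 (adj_of_not_adj hT hyr fun h => ?_), hZY' hz hy⟩
    exact notMem_empty y (hcommon ▸ mem_commonIn.2 ⟨hY'f hy, h⟩)
  have hzc := card_outIn_outs_add_card_outIn_add_one_le hT hzr hZr
  exact hasKTree_of_between_of_commonIn_eq_empty hT (by omega) hc hn hfr.symm (by omega) (by omega)
    (by rw [commonIn_comm, hcommon]) hz (by omega) (by omega) (by omega)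

theorem hasKTree_of_card_commonIn_le_one (hT : T.IsTournament) (hc1 : 1 ≤ c) (hc : c ≤ 4)
    (hn : Fintype.card V = 9 + c) (hfr : f ≠ r) (hf : 4 ≤ #(outs T f)) (hr5 : 5 ≤ #(outs T r))
    (hfr' : #(outs T f) ≤ #(outs T r)) (hr : 3 + c ≤ #(outs T r))
    (hcommon : #(commonIn T f r) ≤ 1) : HasKTree 4 T univ := by
  rcases Nat.le_one_iff_eq_zero_or_eq_one.1 hcommon with h | h
  · have hcard := card_outs_union_add hT hfr
    have hle := card_union_le (outs T f) (outs T r)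
    rw [card_eq_zero] at h
    rw [h, card_empty] at hcard
    by_cases hr4 : 4 + c ≤ #(outs T r)
    · exact hasKTree_of_commonIn_eq_empty_of_four_add_le hT hc1 hc hn hfr hf hr4 h
    · exact hasKTree_of_commonIn_eq_empty_of_eq_three_add hT (by omega) hc hn hfr (by omega) hfr'
        (by omega) h
  · obtain ⟨w, hw⟩ := card_eq_one.1 h
    exact hasKTree_of_commonIn_eq_singleton hT hc1 hc hn hfr hf (by omega) hr hw

end NoCommonInNeighbor

section TwoCommonInNeighbors

variable [Fintype V] {T : Digraph V} [DecidableEq V] {k c : ℕ} {f r w w' : V}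

theorem card_outs_add_two_le {v x y : V} {E : Finset V} (hxy : x ≠ y) (hx : x ∈ E) (hy : y ∈ E)
    (hvx : ¬ T.Adj v x) (hvy : ¬ T.Adj v y) : #(outs T v) + 2 ≤ #(outs T v ∪ E) := by
  rw [← card_pair hxy]
  exact card_outs_add_card_le (insert_subset hx (singleton_subset_iff.2 hy)) (by simp [hvx, hvy])

theorem exists_commonIn_eq_pair (hT : T.IsTournament) (hcommon : #(commonIn T f r) = 2) :
    ∃ w w', commonIn T f r = {w, w'} ∧ T.Adj w w' := by
  obtain ⟨w, w', hne, h⟩ := card_eq_two.1 hcommon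
  by_cases hw : T.Adj w w'
  · exact ⟨w, w', h, hw⟩
  · exact ⟨w', w, by rw [h, pair_comm], adj_of_not_adj hT hne hw⟩

theorem insert_insert_singleton_subset_outs (hcommon : commonIn T f r = {w, w'})
    (hww : T.Adj w w') : {f, r, w'} ⊆ outs T w := by
  have hw : w ∈ commonIn T f r := by simp [hcommon]
  simp [insert_subset_iff, mem_commonIn.1 hw, hww]

omit [Fintype V] in
theorem card_insert_insert_singleton (hT : T.IsTournament) (hfr : f ≠ r) (hwf : T.Adj w f)
    (hwr : T.Adj w r) : #{f, r, w} = 3 :=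
  card_eq_three.2 ⟨f, r, w, hfr, (adj_ne hT hwf).symm, (adj_ne hT hwr).symm, rfl⟩

theorem hasKTree_of_commonIn_eq_pair (hT : T.IsTournament) (hc2 : 2 ≤ c) (hc : c ≤ k)
    (hn : Fintype.card V = 2 * k + 1 + c) (hfr : f ≠ r) (hf : k + c ≤ #(outs T f) + 2)
    (hr : k + c ≤ #(outs T r) + 2) (hcommon : commonIn T f r = {w, w'}) (hww : T.Adj w w')
    (hw : c ≤ #(outs T w)) : HasKTree k T univ := by
  obtain ⟨hwf, hwr⟩ := mem_commonIn.1 (by simp [hcommon] : w ∈ commonIn T f r)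
  obtain ⟨hwf', hwr'⟩ := mem_commonIn.1 (by simp [hcommon] : w' ∈ commonIn T f r)
  have hunion {g : V} (hg : T.Adj w g) (hg' : T.Adj w' g) (hgc : k + c ≤ #(outs T g) + 2) :
      k + c ≤ #(outs T g ∪ outs T w) :=
    hgc.trans (card_outs_add_two_le (adj_ne hT hg').symm (mem_outs.2 hg) (mem_outs.2 hww) (hT.1 g)
      (adj_asymm hT hg'))
  exact hasKTree_of_root_above hT hc hn hfr hwf hwr (by omega) (by omega) (by simp [hcommon, hww])
    (hcommon ▸ card_le_two.trans hc2) hw (hunion hwf hwf' hf) (hunion hwr hwr' hr)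

theorem adj_of_mem_ins_erase_of_outs_eq (hT : T.IsTournament) (hwf' : T.Adj w' f)
    (hwr' : T.Adj w' r) (houts : outs T w = {f, r, w'}) {x : V} (hx : x ∈ (ins T w').erase w) :
    T.Adj x w := by
  obtain ⟨hxw, hxw'⟩ := mem_erase.1 hx
  rw [mem_ins] at hxw'
  refine adj_of_not_adj hT hxw.symm fun h => ?_
  have hx : x ∈ ({f, r, w'} : Finset V) := houts ▸ mem_outs.2 h
  simp only [mem_insert, mem_singleton] at hx
  rcases hx with rfl | rfl | rfl
  · exact adj_asymm hT hwf' hxw'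
  · exact adj_asymm hT hwr' hxw'
  · exact hT.1 x hxw'

theorem hasKTree_of_commonIn_eq_pair_of_subset_ins (hT : T.IsTournament) (hc2 : 2 ≤ c) (hc : c ≤ k)
    (hn : Fintype.card V = 2 * k + 1 + c) (hfr : f ≠ r) (hf : k + c ≤ #(outs T f) + 2)
    (hr : k + c ≤ #(outs T r) + 2) (hcommon : commonIn T f r = {w, w'}) (hww : w ≠ w')
    {X : Finset V} (hXw : X ⊆ ins T w) (hXw' : X ⊆ ins T w') (hX : 2 * c ≤ #X + 4)
    (hX0 : X.Nonempty) : HasKTree k T univ := by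
  obtain ⟨hwf, hwr⟩ := mem_commonIn.1 (by simp [hcommon] : w ∈ commonIn T f r)
  obtain ⟨hwf', hwr'⟩ := mem_commonIn.1 (by simp [hcommon] : w' ∈ commonIn T f r)
  have hXne {g : V} (hg : T.Adj w g) : g ∉ X := fun h => adj_asymm hT hg (mem_ins.1 (hXw h))
  have hwX : w ∉ X := fun h => hT.1 w (mem_ins.1 (hXw h))
  have hwX' : w' ∉ X := fun h => hT.1 w' (mem_ins.1 (hXw' h))
  obtain ⟨q, hq, hqX⟩ := exists_card_le_outIn hT hX0
  have hsub : outIn T X q ⊆ X := outIn_subset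
  set E := insert w (insert w' (outIn T X q)) with hE
  have hEq : E ⊆ outs T q := by
    simp only [hE, insert_subset_iff, mem_outs, mem_ins.1 (hXw hq), mem_ins.1 (hXw' hq), true_and]
    exact fun x hx => mem_outs.2 (mem_outIn.1 hx).2
  have hEcard : #E = #(outIn T X q) + 2 := by
    have hwE : w ∉ insert w' (outIn T X q) := by simpa [hww] using fun h _ => hwX h
    rw [card_insert_of_notMem hwE, card_insert_of_notMem fun h => hwX' (hsub h)]
  have hgE {g : V} (hg : T.Adj w g) (hg' : T.Adj w' g) : g ∉ E := by
    simpa [hE, (adj_ne hT hg).symm, (adj_ne hT hg').symm] using fun h _ => hXne hg h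
  have hunion {g : V} (hg : T.Adj w g) (hg' : T.Adj w' g) : #(outs T g) + 2 ≤ #(outs T g ∪ E) :=
    card_outs_add_two_le hww (by simp [hE]) (by simp [hE]) (adj_asymm hT hg) (adj_asymm hT hg')
  exact hasKTree_of_root_left_or_right hT hc hn hfr (ne_of_mem_of_not_mem hq (hXne hwf))
    (ne_of_mem_of_not_mem hq (hXne hwr)) (by omega) (by omega) hEq (hgE hwf hwf') (hgE hwr hwr')
    (by simp [hcommon, hE, insert_subset_iff]) (hcommon ▸ card_le_two.trans hc2) (by omega)
    (hf.trans (hunion hwf hwf')) (hr.trans (hunion hwr hwr'))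

theorem hasKTree_of_commonIn_eq_pair_of_card_outs_le_three (hT : T.IsTournament)
    (hn : Fintype.card V = 13) (hfr : f ≠ r) (hf : 6 ≤ #(outs T f)) (hr : 6 ≤ #(outs T r))
    (hcommon : commonIn T f r = {w, w'}) (hww : T.Adj w w') (hw : #(outs T w) ≤ 3)
    (hw' : #(outs T w') ≤ 7) : HasKTree 4 T univ := by
  obtain ⟨hwf', hwr'⟩ := mem_commonIn.1 (by simp [hcommon] : w' ∈ commonIn T f r)
  have houts : outs T w = {f, r, w'} :=
    (eq_of_subset_of_card_le (insert_insert_singleton_subset_outs hcommon hww)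
      (by rwa [card_insert_insert_singleton hT hfr hwf' hwr'])).symm
  have hX : 4 ≤ #((ins T w').erase w) := by
    have := card_outs_add_card_ins hT w'
    rw [card_erase_of_mem (mem_ins.2 hww)]
    omega
  exact hasKTree_of_commonIn_eq_pair_of_subset_ins (k := 4) (c := 4) hT (by norm_num) le_rfl hn hfr
    (by omega) (by omega) hcommon (adj_ne hT hww)
    (fun x hx => mem_ins.2 (adj_of_mem_ins_erase_of_outs_eq hT hwf' hwr' houts hx))
    (erase_subset _ _) (by omega) (card_pos.1 (by omega))

theorem card_outs_le_or_exists_adj_of_card_commonIn_eq_two (hT : T.IsTournament) (hc2 : 2 ≤ c)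
    (hc : c ≤ 4) (hn : Fintype.card V = 9 + c) (hfr : f ≠ r) (hr : 2 + c ≤ #(outs T r))
    (hcommon : #(commonIn T f r) = 2) (hno : ¬ HasKTree 4 T univ) :
    #(outs T f) ≤ 1 + c ∨ c = 4 ∧ ∃ w, T.Adj w f ∧ T.Adj w r ∧ #(outs T w) ≤ 3 := by
  obtain ⟨w, w', hpair, hww⟩ := exists_commonIn_eq_pair hT hcommon
  obtain ⟨hwf, hwr⟩ := mem_commonIn.1 (by simp [hpair] : w ∈ commonIn T f r)
  obtain ⟨hwf', hwr'⟩ := mem_commonIn.1 (by simp [hpair] : w' ∈ commonIn T f r)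
  have hw3 : 3 ≤ #(outs T w) := (card_insert_insert_singleton hT hfr hwf' hwr').ge.trans
    (card_le_card (insert_insert_singleton_subset_outs hpair hww))
  by_cases hwc : c ≤ #(outs T w)
  · refine Or.inl (not_lt.1 fun hf => hno ?_)
    exact hasKTree_of_commonIn_eq_pair hT hc2 hc hn hfr (by omega) (by omega) hpair hww hwc
  · exact Or.inr ⟨by omega, w, hwf, hwr, by omega⟩

theorem card_outs_le_five_of_card_commonIn_eq_two (hT : T.IsTournament)
    (hn : Fintype.card V = 13) (hfr : f ≠ r) (hr : 6 ≤ #(outs T r))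
    (hmax : ∀ v, #(outs T v) ≤ 7) (hcommon : #(commonIn T f r) = 2) (hno : ¬ HasKTree 4 T univ) :
    #(outs T f) ≤ 5 := by
  by_contra! hf
  obtain ⟨w, w', hpair, hww⟩ := exists_commonIn_eq_pair hT hcommon
  apply hno
  by_cases hw : 4 ≤ #(outs T w)
  · exact hasKTree_of_commonIn_eq_pair hT (c := 4) (by norm_num) le_rfl hn hfr (by omega)
      (by omega) hpair hww hw
  · exact hasKTree_of_commonIn_eq_pair_of_card_outs_le_three hT hn hfr hf hr hpair hww (by omega)
      (hmax w')

end TwoCommonInNeighbors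

section Regular

variable [Fintype V] {T : Digraph V} [DecidableEq V] {r s w : V}

omit [Fintype V] [DecidableEq V] in
theorem exists_card_outIn_pos_lt (hT : T.IsTournament) {S : Finset V} (hS : 3 ≤ #S) :
    ∃ q ∈ S, 0 < #(outIn T S q) ∧ #(outIn T S q) + 1 < #S := by
  by_contra! hlarge
  set H : Finset V := {q ∈ S | 0 < #(outIn T S q)}
  have hH : #S - 1 ≤ #H := by
    have : #S ≤ #H + 1 := card_le_card_filter_lt_card_outIn_add hT S 0
    omega
  have hsum : #H * (#S - 1) ≤ ∑ q ∈ H, #(outIn T S q) :=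
    card_nsmul_le_sum _ _ _ fun q hq => by
      have := hlarge q (mem_filter.1 hq).1 (mem_filter.1 hq).2
      omega
  have hHS : ∑ q ∈ H, #(outIn T S q) ≤ ∑ q ∈ S, #(outIn T S q) :=
    sum_le_sum_of_subset (filter_subset _ _)
  have htotal := sum_card_outIn hT S
  obtain ⟨m, hm⟩ := Nat.exists_eq_add_of_le hS
  rw [hm] at hH hsum htotal
  simp only [show 3 + m - 1 = m + 2 by omega] at hH hsum htotal
  nlinarith

theorem hasKTree_of_regular_of_commonIn_eq_empty (hT : T.IsTournament)
    (hn : Fintype.card V = 13) (hreg : ∀ v, #(outs T v) = 6) (hsr : T.Adj s r)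
    (hcommon : commonIn T s r = ∅) : HasKTree 4 T univ := by
  have hins := card_outs_add_card_ins hT r
  have hs := card_outs_eq_of_adj hT hsr
  have hJ := card_commonIn_add_card_outIn_ins hT hsr
  rw [hreg] at hins hs
  rw [hcommon, card_empty] at hJ
  have hsr0 : outIn T (outs T r) s = ∅ := card_eq_zero.1 (by omega)
  set J := outIn T (ins T r) s with hJdef
  obtain ⟨q, hq, hq0, hqJ⟩ := exists_card_outIn_pos_lt hT (by omega : 3 ≤ #J)
  obtain ⟨hqr, hsq⟩ : T.Adj q r ∧ T.Adj s q := by simpa [hJdef] using hq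
  have hqs := adj_asymm hT hsq
  have hqsub : outIn T (ins T r) q ⊆ outIn T J q := fun x hx => by
    obtain ⟨hxr, hqx⟩ := mem_outIn.1 hx
    refine mem_outIn.2 ⟨mem_outIn.2 ⟨hxr, ?_⟩, hqx⟩
    refine adj_of_not_adj hT (by rintro rfl; exact hqs hqx) fun hxs => ?_
    exact notMem_empty x (hcommon ▸ mem_commonIn.2 ⟨hxs, mem_ins.1 hxr⟩)
  have hqcard := card_outs_eq_of_adj hT hqr
  have hqle := card_le_card hqsub
  have hsq' : #(outs T s) + #(outIn T (outs T r) q) ≤ #(outs T s ∪ outs T q) :=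
    card_outs_add_card_le (fun x hx => mem_outs.2 (mem_outIn.1 hx).2) fun x hx h =>
      notMem_empty x (hsr0 ▸ mem_outIn.2 ⟨(mem_outIn.1 hx).1, h⟩)
  have hrq := card_outs_add_card_outIn_add_one_le (X := J) hT hqr outIn_subset
  rw [hreg] at hqcard hsq' hrq
  exact hasKTree_of_root_left (k := 4) (c := 4) hT le_rfl hn hsr (adj_ne hT hsq).symm
    (adj_ne hT hqr) (by simp [hreg]) (by simp [hreg]) Subset.rfl (by simpa using hqs)
    (by simp [hcommon]) (by simp [hcommon]) (by simp [hreg]) (by omega) (by omega)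

theorem hasKTree_of_regular_of_exists_adj (hT : T.IsTournament)
    (hn : Fintype.card V = 13) (hreg : ∀ v, #(outs T v) = 6) (hsr : T.Adj s r)
    (hcommon : commonIn T s r = {w}) {z : V} (hwz : T.Adj w z) (hzs : z ≠ s) (hsz : ¬ T.Adj s z) :
    HasKTree 4 T univ := by
  obtain ⟨hws, hwr⟩ := mem_commonIn.1 (by simp [hcommon] : w ∈ commonIn T s r)
  have hsw := card_outs_add_two_le (E := outs T w) hzs (mem_outs.2 hwz) (mem_outs.2 hws) hsz
    (hT.1 s)
  have hrw := card_outs_add_two_le (E := outs T w) (adj_ne hT hsr) (mem_outs.2 hws)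
    (mem_outs.2 hwr) (adj_asymm hT hsr) (hT.1 r)
  rw [hreg] at hsw hrw
  exact hasKTree_of_root_above (k := 4) (c := 4) hT le_rfl hn (adj_ne hT hsr) hws hwr
    (by simp [hreg]) (by simp [hreg]) (by simp [hcommon]) (by simp [hcommon]) (by simp [hreg]) hsw
    hrw

theorem hasKTree_of_regular_of_adj (hT : T.IsTournament) (hn : Fintype.card V = 13)
    (hreg : ∀ v, #(outs T v) = 6) (hcommon : commonIn T s r = {w}) {x j : V} (hxs : T.Adj x s)
    (hrx : T.Adj r x) (hxw : T.Adj x w) (hsj : T.Adj s j) (hjr : T.Adj j r) (hxj : T.Adj x j) :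
    HasKTree 4 T univ := by
  obtain ⟨hws, hwr⟩ := mem_commonIn.1 (by simp [hcommon] : w ∈ commonIn T s r)
  have hsx := card_outs_add_two_le (E := outs T x) (adj_ne hT hws) (mem_outs.2 hxw)
    (mem_outs.2 hxs) (adj_asymm hT hws) (hT.1 s)
  have hwj : w ≠ j := by
    rintro rfl
    exact adj_asymm hT hws hsj
  have hrx' := card_outs_add_two_le (E := (outs T x).erase s) hwj
    (mem_erase.2 ⟨adj_ne hT hws, mem_outs.2 hxw⟩)
    (mem_erase.2 ⟨(adj_ne hT hsj).symm, mem_outs.2 hxj⟩) (adj_asymm hT hwr) (adj_asymm hT hjr)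
  have hsr : s ≠ r := by
    rintro rfl
    exact adj_asymm hT hsj hjr
  rw [hreg] at hsx hrx'
  exact hasKTree_of_between (k := 4) (c := 4) hT le_rfl hn hsr hxs hrx (by simp [hreg])
    (by simp [hreg]) (by simp [hcommon, mem_outs.2 hxw]) (by simp [hcommon]) (by simp [hreg]) hsx
    hrx'

omit [DecidableEq V] in
theorem exists_adj_of_card_commonIn_eq_one (hT : T.IsTournament) (hn : Fintype.card V = 13)
    (hreg : ∀ v, #(outs T v) = 6) (hsr : T.Adj s r) (hcommon : #(commonIn T s r) = 1) :
    ∃ x j, T.Adj r x ∧ T.Adj x s ∧ T.Adj s j ∧ T.Adj j r ∧ T.Adj x j := by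
  classical
  by_contra! hno
  have hins := card_outs_add_card_ins hT r
  have hs := card_outs_eq_of_adj hT hsr
  have hJ := card_commonIn_add_card_outIn_ins hT hsr
  rw [hreg] at hins hs
  set J := outIn T (ins T r) s with hJdef
  have hJs {j : V} (hj : j ∈ J) : T.Adj j r ∧ T.Adj s j := by simpa [hJdef] using hj
  set X := outs T r \ outIn T (outs T r) s with hXdef
  have hX : #X = 5 := by
    rw [hXdef, card_sdiff_of_subset outIn_subset, hreg]
    omega
  have hXs {x : V} (hx : x ∈ X) : T.Adj r x ∧ T.Adj x s := by
    obtain ⟨hrx, hsx⟩ : T.Adj r x ∧ ¬ T.Adj s x := by grind [mem_outs, mem_outIn]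
    exact ⟨hrx, adj_of_not_adj hT (by rintro rfl; exact adj_asymm hT hsr hrx) hsx⟩
  obtain ⟨j, hj, hjJ⟩ := exists_card_le_outIn hT (card_pos.1 (by omega : 0 < #J))
  obtain ⟨hjr, hsj⟩ := hJs hj
  obtain ⟨j', hj'⟩ := card_pos.1 (by omega : 0 < #(outIn T J j))
  obtain ⟨hj'J, hjj'⟩ := mem_outIn.1 hj'
  obtain ⟨hj'r, -⟩ := hJs hj'J
  have hsub : insert r (insert j' X) ⊆ outs T j := by
    simp only [insert_subset_iff, mem_outs, hjr, hjj', true_and]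
    refine fun x hx => mem_outs.2 (adj_of_not_adj hT ?_ ?_)
    · rintro rfl
      exact adj_asymm hT (hXs hx).1 hjr
    · exact hno x j (hXs hx).1 (hXs hx).2 hsj hjr
  have hj'X : j' ∉ X := fun h => adj_asymm hT (hXs h).1 hj'r
  have hrX : r ∉ insert j' X := by
    simpa [(adj_ne hT hj'r).symm] using fun h => hT.1 r (hXs h).1
  have hcard := card_le_card hsub
  rw [card_insert_of_notMem hrX, card_insert_of_notMem hj'X, hreg] at hcard
  omega

theorem hasKTree_of_regular_of_commonIn_eq_singleton (hT : T.IsTournament)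
    (hn : Fintype.card V = 13) (hreg : ∀ v, #(outs T v) = 6) (hsr : T.Adj s r)
    (hcommon : commonIn T s r = {w}) : HasKTree 4 T univ := by
  obtain ⟨-, hwr⟩ := mem_commonIn.1 (by simp [hcommon] : w ∈ commonIn T s r)
  obtain ⟨x, j, hrx, hxs, hsj, hjr, hxj⟩ :=
    exists_adj_of_card_commonIn_eq_one hT hn hreg hsr (by simp [hcommon])
  by_cases hxw : T.Adj x w
  · exact hasKTree_of_regular_of_adj hT hn hreg hcommon hxs hrx hxw hsj hjr hxj
  · have hxw' : x ≠ w := by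
      rintro rfl
      exact adj_asymm hT hwr hrx
    exact hasKTree_of_regular_of_exists_adj hT hn hreg hsr hcommon (adj_of_not_adj hT hxw' hxw)
      (adj_ne hT hxs) (adj_asymm hT hxs)

theorem hasKTree_of_regular (hT : T.IsTournament) (hn : Fintype.card V = 13)
    (hreg : ∀ v, #(outs T v) = 6) : HasKTree 4 T univ := by
  obtain ⟨r⟩ : Nonempty V := Fintype.card_pos_iff.1 (by omega)
  have hins := card_outs_add_card_ins hT r
  rw [hreg] at hins
  obtain ⟨s, hs, hsout⟩ := exists_card_le_outIn hT (card_pos.1 (by omega : 0 < #(ins T r)))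
  have hsr := mem_ins.1 hs
  have hcommon := card_commonIn_add_card_outIn_ins hT hsr
  have hle : #(commonIn T s r) ≤ 2 := by omega
  interval_cases h : #(commonIn T s r)
  · exact hasKTree_of_regular_of_commonIn_eq_empty hT hn hreg hsr (card_eq_zero.1 h)
  · obtain ⟨w, hw⟩ := card_eq_one.1 h
    exact hasKTree_of_regular_of_commonIn_eq_singleton hT hn hreg hsr hw
  · obtain ⟨w, w', hpair, hww⟩ := exists_commonIn_eq_pair hT h
    exact hasKTree_of_commonIn_eq_pair (k := 4) (c := 4) hT (by norm_num) le_rfl hn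
      (adj_ne hT hsr) (by simp [hreg]) (by simp [hreg]) hpair hww (by simp [hreg])

end Regular

section Counting

variable [Fintype V] {T : Digraph V} {r : V}

theorem sum_card_commonIn (r : V) :
    ∑ x ∈ outs T r, #(commonIn T x r) = ∑ s ∈ ins T r, #(outIn T (outs T r) s) := by
  classical
  have hcount := sum_card_bipartiteAbove_eq_sum_card_bipartiteBelow (s := ins T r) (t := outs T r)
    T.Adj
  have hcommon (x : V) : commonIn T x r = (ins T r).bipartiteBelow T.Adj x := by
    ext y
    simp [bipartiteBelow, and_comm]
  have hout (s : V) : outIn T (outs T r) s = (outs T r).bipartiteAbove T.Adj s := by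
    ext y
    simp [bipartiteAbove]
  simp only [hcommon, hout, hcount]

/-- Every vertex counted on the left has an in-neighbour in `K`. -/
theorem card_filter_two_le_card_commonIn_le {K : Finset V} (hK : K ⊆ ins T r)
    (hKcard : #(ins T r) ≤ #K + 1) :
    #{x ∈ outs T r | 2 ≤ #(commonIn T x r)} ≤ ∑ s ∈ K, #(outIn T (outs T r) s) := by
  classical
  refine le_trans (card_le_card fun x hx => ?_) card_biUnion_le
  obtain ⟨hxr, hx2⟩ := mem_filter.1 hx
  by_contra hxK
  have hsub : commonIn T x r ⊆ ins T r \ K := fun y hy => by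
    obtain ⟨hyx, hyr⟩ := mem_commonIn.1 hy
    exact mem_sdiff.2 ⟨mem_ins.2 hyr, fun hyK =>
      hxK (mem_biUnion.2 ⟨y, hyK, mem_outIn.2 ⟨hxr, hyx⟩⟩)⟩
  have hcard := card_le_card hsub
  rw [card_sdiff_of_subset hK] at hcard
  omega

theorem sum_le_mul_card_add_mul_card_filter {ι : Type*} (s : Finset ι) {g : ι → ℕ} (p : ι → Prop)
    [DecidablePred p] {m M : ℕ} (hm : ∀ x ∈ s, ¬ p x → g x ≤ m) (hM : ∀ x ∈ s, g x ≤ m + M) :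
    ∑ x ∈ s, g x ≤ m * #s + M * #{x ∈ s | p x} := by
  calc ∑ x ∈ s, g x ≤ ∑ x ∈ s, (m + if p x then M else 0) := by
        refine sum_le_sum fun x hx => ?_
        split_ifs with hp
        · exact hM x hx
        · exact hm x hx hp
    _ = m * #s + M * #{x ∈ s | p x} := by
        rw [sum_add_distrib, ← sum_filter, sum_const, sum_const, smul_eq_mul, smul_eq_mul,
          mul_comm m, mul_comm M]

/-- `T` is a tournament of order `9 + c`, where `1 ≤ c ≤ 4`, without a spanning `4`-ary tree, and
`r` is a vertex of maximum out-degree. The orders `10, …, 13` are refuted by counting arcs for each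
possible in-degree of `r`. -/
structure IsCounterexampleAt (T : Digraph V) (c : ℕ) (r : V) : Prop where
  isTournament : T.IsTournament
  one_le : 1 ≤ c
  le_four : c ≤ 4
  card_eq : Fintype.card V = 9 + c
  card_outs_le : ∀ v, #(outs T v) ≤ #(outs T r)
  not_hasKTree : ∀ [DecidableEq V], ¬ HasKTree 4 T univ

namespace IsCounterexampleAt

variable {c : ℕ} {f s : V}

theorem card_outs_add_card_ins (h : IsCounterexampleAt T c r) :
    #(outs T r) + #(ins T r) = 8 + c := by
  have := KAryTree.card_outs_add_card_ins h.isTournament r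
  have := h.card_eq
  omega

theorem eight_add_le (h : IsCounterexampleAt T c r) : 8 + c ≤ 2 * #(outs T r) := by
  obtain ⟨v, -, hv⟩ := exists_card_le_outIn h.isTournament ⟨r, mem_univ r⟩
  have hvr : #(outIn T univ v) ≤ #(outs T r) := h.card_outs_le v
  rw [card_univ, h.card_eq] at hv
  omega

theorem card_outs_le_three (h : IsCounterexampleAt T c r) (hI : #(ins T r) ≤ 5) (hf : f ≠ r)
    (hcommon : #(commonIn T f r) ≤ 1) : #(outs T f) ≤ 3 := by
  classical
  by_contra! hf4
  have hcard := h.card_outs_add_card_ins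
  have h8 := h.eight_add_le
  have h1 := h.one_le
  exact h.not_hasKTree (hasKTree_of_card_commonIn_le_one h.isTournament h1 h.le_four h.card_eq hf
    hf4 (by omega) (h.card_outs_le f) (by omega) hcommon)

theorem card_outs_le_three_of_mem_ins (h : IsCounterexampleAt T c r) (hI : #(ins T r) ≤ 5)
    (hs : s ∈ ins T r) (hout : #(ins T r) ≤ #(outIn T (ins T r) s) + 2) : #(outs T s) ≤ 3 := by
  have := card_commonIn_add_card_outIn_ins h.isTournament (mem_ins.1 hs)
  exact h.card_outs_le_three hI (adj_ne h.isTournament (mem_ins.1 hs)) (by omega)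

theorem card_outIn_ins_le_two (h : IsCounterexampleAt T c r) (hI : #(ins T r) ≤ 5)
    (hs : s ∈ ins T r) : #(outIn T (ins T r) s) ≤ 2 := by
  by_contra! hout
  have := h.card_outs_le_three_of_mem_ins hI hs (by omega)
  have := card_outs_eq_of_adj h.isTournament (mem_ins.1 hs)
  omega

theorem sum_outs_le (h : IsCounterexampleAt T c r) (hI : #(ins T r) ≤ 5) {b : ℕ}
    (hb : #{x ∈ outs T r | 2 ≤ #(commonIn T x r)} ≤ b) :
    ∑ x ∈ outs T r, #(outs T x) ≤ 3 * #(outs T r) + (#(outs T r) - 3) * b := by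
  refine (sum_le_mul_card_add_mul_card_filter _ (fun x => 2 ≤ #(commonIn T x r))
    (M := #(outs T r) - 3) (fun x hx hx2 => ?_) fun x _ => ?_).trans (by gcongr)
  · exact h.card_outs_le_three hI (adj_ne h.isTournament (mem_outs.1 hx)).symm (by omega)
  · have := h.card_outs_le x
    omega

theorem sum_ins_le (h : IsCounterexampleAt T c r) {K : Finset V} (hK : K ⊆ ins T r)
    (hKout : ∀ s ∈ K, #(outs T s) ≤ 3) :
    ∑ s ∈ ins T r, #(outs T s) ≤ 3 * #K + (#(ins T r) - #K) * #(outs T r) := by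
  classical
  rw [← sum_sdiff hK, add_comm, mul_comm 3, ← card_sdiff_of_subset hK]
  exact add_le_add (sum_le_card_nsmul _ _ _ hKout) (sum_le_card_nsmul _ _ _ fun s _ =>
    h.card_outs_le s)

theorem mul_eq_two_mul_sum (h : IsCounterexampleAt T c r) :
    (9 + c) * (8 + c) = 2 * (#(outs T r) +
      (∑ x ∈ outs T r, #(outs T x) + ∑ s ∈ ins T r, #(outs T s))) := by
  rw [← sum_eq_add_sum_outs_add_sum_ins h.isTournament r fun v => #(outs T v),
    sum_card_outIn h.isTournament, card_univ, h.card_eq, show 9 + c - 1 = 8 + c by omega]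

theorem two_le_card_ins (h : IsCounterexampleAt T c r) : 2 ≤ #(ins T r) := by
  by_contra! hI
  have hcard := h.card_outs_add_card_ins
  have htotal := h.mul_eq_two_mul_sum
  have houts := h.sum_outs_le (by omega)
    (card_filter_two_le_card_commonIn_le (empty_subset _) (by rw [card_empty]; omega))
  have hins := h.sum_ins_le Subset.rfl fun s hs =>
    h.card_outs_le_three_of_mem_ins (by omega) hs (by omega)
  rw [sum_empty, mul_zero] at houts
  rw [Nat.sub_self, zero_mul] at hins
  obtain ⟨h1, h4⟩ := And.intro h.one_le h.le_four
  interval_cases c <;> omega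

theorem card_ins_ne_two (h : IsCounterexampleAt T c r) : #(ins T r) ≠ 2 := by
  intro hI
  have hcard := h.card_outs_add_card_ins
  have htotal := h.mul_eq_two_mul_sum
  have hout3 {s : V} (hs : s ∈ ins T r) : #(outs T s) ≤ 3 :=
    h.card_outs_le_three_of_mem_ins (by omega) hs (by omega)
  have hins := h.sum_ins_le Subset.rfl fun s => hout3
  rw [Nat.sub_self, zero_mul] at hins
  obtain ⟨s, hs⟩ := card_pos.1 (by omega : 0 < #(ins T r))
  have hfilter := card_filter_two_le_card_commonIn_le (singleton_subset_iff.2 hs)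
    (by rw [hI, card_singleton])
  rw [sum_singleton] at hfilter
  have hsout := card_outs_eq_of_adj h.isTournament (mem_ins.1 hs)
  have hs3 := hout3 hs
  have houts := h.sum_outs_le (b := 2) (by omega) (by omega)
  obtain ⟨h1, h4⟩ := And.intro h.one_le h.le_four
  interval_cases c <;> omega

theorem card_ins_ne_three (h : IsCounterexampleAt T c r) : #(ins T r) ≠ 3 := by
  intro hI
  have hT := h.isTournament
  have hcard := h.card_outs_add_card_ins
  have htotal := h.mul_eq_two_mul_sum
  have hlow := card_le_card_filter_lt_card_outIn_add hT (ins T r) 0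
  obtain ⟨K, hK, hKcard⟩ := exists_subset_card_eq
    (by omega : 2 ≤ #{s ∈ ins T r | 0 < #(outIn T (ins T r) s)})
  have hKins : K ⊆ ins T r := hK.trans (filter_subset _ _)
  have hKout {s : V} (hs : s ∈ K) : #(outs T s) ≤ 3 ∧ #(outIn T (outs T r) s) ≤ 1 := by
    have hs0 : 0 < #(outIn T (ins T r) s) := (mem_filter.1 (hK hs)).2
    have hs3 := h.card_outs_le_three_of_mem_ins (by omega) (hKins hs) (by omega)
    have := card_outs_eq_of_adj hT (mem_ins.1 (hKins hs))
    omega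
  have hfilter := card_filter_two_le_card_commonIn_le hKins (by omega)
  have hsumK : ∑ s ∈ K, #(outIn T (outs T r) s) ≤ #K * 1 :=
    sum_le_card_nsmul _ _ _ fun s hs => (hKout hs).2
  have houts := h.sum_outs_le (b := 2) (by omega) (by omega)
  have hins := h.sum_ins_le hKins fun s hs => (hKout hs).1
  rw [hI, hKcard] at hins
  obtain ⟨h1, h4⟩ := And.intro h.one_le h.le_four
  interval_cases c <;> omega

theorem exists_subset_ins_of_card_ins_eq_four (h : IsCounterexampleAt T c r)
    (hI : #(ins T r) = 4) :
    ∃ K ⊆ ins T r, #K = 2 ∧ ∀ s ∈ K, #(outs T s) ≤ 3 ∧ outIn T (outs T r) s = ∅ := by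
  have hsum := sum_card_outIn h.isTournament (ins T r)
  have hle := sum_le_mul_card_add_mul_card_filter (ins T r) (m := 1) (M := 1)
    (fun s => #(outIn T (ins T r) s) = 2)
    (fun s hs hs2 => by have := h.card_outIn_ins_le_two (by omega) hs; omega)
    (fun s hs => h.card_outIn_ins_le_two (by omega) hs)
  rw [hI] at hsum hle
  obtain ⟨K, hK, hKcard⟩ := exists_subset_card_eq
    (by omega : 2 ≤ #{s ∈ ins T r | #(outIn T (ins T r) s) = 2})
  refine ⟨K, hK.trans (filter_subset _ _), hKcard, fun s hs => ?_⟩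
  obtain ⟨hsr, hs2⟩ := mem_filter.1 (hK hs)
  have hs3 := h.card_outs_le_three_of_mem_ins (by omega) hsr (by omega)
  have := card_outs_eq_of_adj h.isTournament (mem_ins.1 hsr)
  exact ⟨hs3, card_eq_zero.1 (by omega)⟩

theorem card_filter_two_le_card_commonIn_le_of_notMem {K : Finset V} (hK : K ⊆ ins T r)
    (hKcard : #(ins T r) ≤ #K + 2) (hKout : ∀ s ∈ K, outIn T (outs T r) s = ∅) {t : V}
    (ht : t ∈ ins T r) (htK : t ∉ K) :
    #{x ∈ outs T r | 2 ≤ #(commonIn T x r)} ≤ #(outIn T (outs T r) t) := by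
  classical
  have hfilter := card_filter_two_le_card_commonIn_le (insert_subset ht hK)
    (by rw [card_insert_of_notMem htK]; omega)
  rwa [sum_insert htK, sum_eq_zero fun s hs => by rw [hKout s hs, card_empty], add_zero] at hfilter

theorem card_ins_ne_four_of_le_two (h : IsCounterexampleAt T c r) (hc : c ≤ 2) :
    #(ins T r) ≠ 4 := by
  classical
  intro hI
  have hT := h.isTournament
  have hcard := h.card_outs_add_card_ins
  have htotal := h.mul_eq_two_mul_sum
  obtain ⟨K, hK, hKcard, hKout⟩ := h.exists_subset_ins_of_card_ins_eq_four hI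
  have hins := h.sum_ins_le hK fun s hs => (hKout s hs).1
  have hdiff : #(ins T r \ K) = 2 := by rw [card_sdiff_of_subset hK, hI, hKcard]
  obtain ⟨t, ht, hout⟩ := exists_card_le_outIn hT (card_pos.1 (hdiff.symm ▸ two_pos))
  obtain ⟨htr, htK⟩ := mem_sdiff.1 ht
  have hout_le : #(outIn T (ins T r \ K) t) ≤ #(outIn T (ins T r) t) :=
    card_le_card (outIn_subset_outIn sdiff_subset)
  have htout := card_outs_eq_of_adj hT (mem_ins.1 htr)
  have hmax := h.card_outs_le t
  have hfilter := card_filter_two_le_card_commonIn_le_of_notMem hK (by omega)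
    (fun s hs => (hKout s hs).2) htr htK
  have houts := h.sum_outs_le (b := #(outs T r) - 2) (by omega) (by omega)
  rw [hI, hKcard] at hins
  rw [show #(outs T r) = 4 + c by omega] at htotal hins houts
  have h1 := h.one_le
  interval_cases c <;> omega

theorem card_commonIn_le_two_of_card_ins_eq_four (hI : #(ins T r) = 4) {K : Finset V}
    (hK : K ⊆ ins T r) (hKcard : #K = 2) (hKout : ∀ s ∈ K, outIn T (outs T r) s = ∅)
    (hf : f ∈ outs T r) : #(commonIn T f r) ≤ 2 := by
  classical
  have hsub : commonIn T f r ⊆ ins T r \ K := fun y hy => by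
    obtain ⟨hyf, hyr⟩ := mem_commonIn.1 hy
    exact mem_sdiff.2 ⟨mem_ins.2 hyr, fun hyK => notMem_empty f
      (hKout y hyK ▸ mem_outIn.2 ⟨hf, hyf⟩)⟩
  have hcard := card_le_card hsub
  rwa [card_sdiff_of_subset hK, hI, hKcard] at hcard

theorem card_outs_le_or_exists_adj (h : IsCounterexampleAt T c r) (hc : 2 ≤ c)
    (hI : #(ins T r) ≤ 5) (hr : 2 + c ≤ #(outs T r)) (hf : f ≠ r)
    (hcommon : #(commonIn T f r) ≤ 2) :
    #(outs T f) ≤ 1 + c ∨ c = 4 ∧ ∃ w, T.Adj w f ∧ T.Adj w r ∧ #(outs T w) ≤ 3 := by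
  classical
  rcases hcommon.eq_or_lt with h2 | h1
  · exact card_outs_le_or_exists_adj_of_card_commonIn_eq_two h.isTournament hc h.le_four h.card_eq
      hf hr h2 h.not_hasKTree
  · have := h.card_outs_le_three hI hf (by omega)
    omega

theorem card_ins_ne_four (h : IsCounterexampleAt T c r) : #(ins T r) ≠ 4 := by
  intro hI
  by_cases hc2 : c ≤ 2
  · exact h.card_ins_ne_four_of_le_two hc2 hI
  have h4 := h.le_four
  have hcard := h.card_outs_add_card_ins
  have htotal := h.mul_eq_two_mul_sum
  obtain ⟨K, hK, hKcard, hKout⟩ := h.exists_subset_ins_of_card_ins_eq_four hI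
  have hins := h.sum_ins_le hK fun s hs => (hKout s hs).1
  rw [hI, hKcard] at hins
  by_cases hall : ∀ x ∈ outs T r, #(outs T x) ≤ 1 + c
  · have houts := sum_le_card_nsmul _ _ _ hall
    rw [show #(outs T r) = 4 + c by omega] at htotal hins houts
    interval_cases c <;> simp only [smul_eq_mul] at houts <;> omega
  · push Not at hall
    obtain ⟨x, hx, hxc⟩ := hall
    have hxr := (adj_ne h.isTournament (mem_outs.1 hx)).symm
    obtain ⟨rfl, w, hwx, hwr, hw3⟩ := (h.card_outs_le_or_exists_adj (by omega) (by omega) (by omega)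
      hxr (card_commonIn_le_two_of_card_ins_eq_four hI hK hKcard
        (fun s hs => (hKout s hs).2) hx)).resolve_left (by omega)
    have hwK : w ∉ K := fun hw => notMem_empty x ((hKout w hw).2 ▸ mem_outIn.2 ⟨hx, hwx⟩)
    have hfilter := card_filter_two_le_card_commonIn_le_of_notMem hK (by omega)
      (fun s hs => (hKout s hs).2) (mem_ins.2 hwr) hwK
    have hwout := card_outs_eq_of_adj h.isTournament hwr
    have houts := h.sum_outs_le (b := 2) (by omega) (by omega)
    omega

theorem card_outIn_ins_eq_two (h : IsCounterexampleAt T c r) (hI : #(ins T r) = 5)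
    (hs : s ∈ ins T r) : #(outIn T (ins T r) s) = 2 := by
  have hsum := sum_card_outIn h.isTournament (ins T r)
  rw [hI] at hsum
  refine (sum_eq_sum_iff_of_le fun s => h.card_outIn_ins_le_two hI.le).1 ?_ s hs
  rw [sum_const, hI, smul_eq_mul]
  omega

theorem card_outs_le_of_card_commonIn_le_two (h : IsCounterexampleAt T c r) (hc : 2 ≤ c)
    (hI : #(ins T r) = 5) (hf : f ≠ r) (hcommon : #(commonIn T f r) ≤ 2) :
    #(outs T f) ≤ c + 1 := by
  classical
  have hcard := h.card_outs_add_card_ins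
  rcases h.card_outs_le_or_exists_adj hc hI.le (by omega) hf hcommon with hle | ⟨rfl, -⟩
  · omega
  rcases hcommon.eq_or_lt with h2 | h1
  · exact card_outs_le_five_of_card_commonIn_eq_two h.isTournament h.card_eq hf (by omega)
      (fun v => (h.card_outs_le v).trans (by omega)) h2 h.not_hasKTree
  · have := h.card_outs_le_three hI.le hf (by omega)
    omega

theorem card_outs_le_of_mem_ins (h : IsCounterexampleAt T c r) (hc : 2 ≤ c)
    (hI : #(ins T r) = 5) (hs : s ∈ ins T r) :
    #(outs T s) ≤ c + 1 ∧ #(outIn T (outs T r) s) ≤ c - 2 := by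
  have hadj := mem_ins.1 hs
  have hs2 := h.card_outIn_ins_eq_two hI hs
  have hcommon := card_commonIn_add_card_outIn_ins h.isTournament hadj
  have hout := card_outs_eq_of_adj h.isTournament hadj
  have hle := h.card_outs_le_of_card_commonIn_le_two hc hI (adj_ne h.isTournament hadj) (by omega)
  omega

theorem three_mul_card_filter_le (h : IsCounterexampleAt T c r) (hc : 2 ≤ c)
    (hI : #(ins T r) = 5) :
    3 * #{x ∈ outs T r | 3 ≤ #(commonIn T x r)} ≤ 5 * (c - 2) := by
  calc 3 * #{x ∈ outs T r | 3 ≤ #(commonIn T x r)}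
      ≤ ∑ x ∈ outs T r with 3 ≤ #(commonIn T x r), #(commonIn T x r) := by
        rw [mul_comm, ← smul_eq_mul]
        exact card_nsmul_le_sum _ _ _ fun x hx => (mem_filter.1 hx).2
    _ ≤ ∑ x ∈ outs T r, #(commonIn T x r) := sum_le_sum_of_subset (filter_subset _ _)
    _ = ∑ s ∈ ins T r, #(outIn T (outs T r) s) := sum_card_commonIn r
    _ ≤ 5 * (c - 2) := hI ▸ sum_le_card_nsmul _ _ _ fun s hs =>
        (h.card_outs_le_of_mem_ins hc hI hs).2

theorem card_ins_ne_five (h : IsCounterexampleAt T c r) : #(ins T r) ≠ 5 := by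
  intro hI
  have h4 := h.le_four
  have hcard := h.card_outs_add_card_ins
  have h8 := h.eight_add_le
  have hc : 2 ≤ c := by omega
  have htotal := h.mul_eq_two_mul_sum
  have hins : ∑ s ∈ ins T r, #(outs T s) ≤ 5 * (c + 1) :=
    hI ▸ sum_le_card_nsmul _ _ _ fun s hs => (h.card_outs_le_of_mem_ins hc hI hs).1
  have hfilter := h.three_mul_card_filter_le hc hI
  have houts := sum_le_mul_card_add_mul_card_filter (outs T r) (g := fun x => #(outs T x))
    (p := fun x => 3 ≤ #(commonIn T x r)) (m := c + 1) (M := 2)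
    (fun x hx hx3 => h.card_outs_le_of_card_commonIn_le_two hc hI
      (adj_ne h.isTournament (mem_outs.1 hx)).symm (by omega))
    (fun x _ => by have := h.card_outs_le x; omega)
  rw [show #(outs T r) = 3 + c by omega] at htotal houts
  interval_cases c <;> omega

end IsCounterexampleAt

theorem hasKTree_four_of_card_eq [DecidableEq V] (hT : T.IsTournament) {c : ℕ} (hc1 : 1 ≤ c)
    (hc : c ≤ 4) (hn : Fintype.card V = 9 + c) : HasKTree 4 T univ := by
  by_contra hno
  have huniv : (univ : Finset V).Nonempty := card_pos.1 (by rw [card_univ]; omega)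
  obtain ⟨r, -, hr⟩ := exists_max_image univ (fun v => #(outs T v)) huniv
  have h : IsCounterexampleAt T c r := ⟨hT, hc1, hc, hn, fun v => hr v (mem_univ v),
    fun {_} => by convert hno⟩
  have hcard := h.card_outs_add_card_ins
  have h8 := h.eight_add_le
  by_cases hI : #(ins T r) ≤ 5
  · have hge := h.two_le_card_ins
    interval_cases hins : #(ins T r)
    exacts [h.card_ins_ne_two hins, h.card_ins_ne_three hins, h.card_ins_ne_four hins,
      h.card_ins_ne_five hins]
  · obtain rfl : c = 4 := by omega
    have hle : ∀ v ∈ univ, #(outs T v) ≤ 6 := fun v hv => (hr v hv).trans (by omega)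
    have hsum : 2 * ∑ v, #(outs T v) = _ := sum_card_outIn hT univ
    rw [card_univ, hn] at hsum
    refine hno (hasKTree_of_regular hT hn fun v => (sum_eq_sum_iff_of_le hle).1 ?_ v (mem_univ v))
    rw [sum_const, card_univ, hn, smul_eq_mul]
    omega

end Counting

theorem hasKTree_four [DecidableEq V] {T : Digraph V} (hT : T.IsTournament) (S : Finset V)
    (hS : 10 ≤ #S) : HasKTree 4 T S := by
  induction S using Finset.strongInduction with
  | H S ih =>
    by_cases h13 : #S ≤ 13
    · let T' : Digraph S := ⟨fun x y => T.Adj x y⟩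
      have hT' : T'.IsTournament :=
        ⟨fun x => hT.1 x, fun x y hxy => hT.2 x y (Subtype.coe_ne_coe.2 hxy)⟩
      have htree := hasKTree_four_of_card_eq hT' (c := #S - 9) (by omega) (by omega)
        (by rw [Fintype.card_coe]; omega)
      have hmap := htree.map (T' := T) (Function.Embedding.subtype _) fun _ _ => id
      rwa [univ_eq_attach, attach_map_val] at hmap
    · refine hasKTree_of_forall_sdiff hT (by norm_num) (by omega) fun C hCS hC => ih _ ?_ ?_
      · exact sdiff_ssubset hCS (card_pos.1 (by omega))
      · rw [card_sdiff_of_subset hCS]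
        omega

theorem everyTournamentHasKArySpanningTree_four_ten : EveryTournamentHasKArySpanningTree 4 10 := by
  classical
  intro V _ hV T hT
  exact (hasKTree_four hT univ (by rwa [card_univ])).hasKArySpanningTree

theorem everyTournamentHasKArySpanningTree_hNum {k : ℕ}
    (h : ∃ N, EveryTournamentHasKArySpanningTree k N) :
    EveryTournamentHasKArySpanningTree k (hNum k) :=
  Nat.sInf_mem h

end KAryTree

theorem theorem3 : hNum 4 = 10 ∧ 13 ≤ hNum 5 := by
  have h4 := KAryTree.everyTournamentHasKArySpanningTree_four_ten
  have h5 := KAryTree.exists_everyTournamentHasKArySpanningTree (k := 5) (by norm_num)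
  constructor
  · exact le_antisymm (Nat.sInf_le h4)
      (KAryTree.ten_le_of_everyTournamentHasKArySpanningTree
        (KAryTree.everyTournamentHasKArySpanningTree_hNum ⟨10, h4⟩))
  · exact KAryTree.thirteen_le_of_everyTournamentHasKArySpanningTree
      (KAryTree.everyTournamentHasKArySpanningTree_hNum h5)
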